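/- Let $\mathbb{D}=\{z\in\mathbb{C}:|z|<1\}$, let $\mathcal{A}$ be the class of analytic functions $f$ on $\mathbb{D}$ with $f(0)=0$, $f'(0)=1$, let $\mathcal{S}$ be the class of univalent functions in $\mathcal{A}$, and let $\mathcal{P}$ be the class of analytic functions $p$ on $\mathbb{D}$ with $p(0)=1$ and $\operatorname{Re}p(z)>0$ for all $z\in\mathbb{D}$. Let $k(z)=z/(1-z)^2$ and $$\Pi_1=\{f\in\mathcal{A}: f/g\in\mathcal{P}\text{ for some } g\in\mathcal{A}\text{ with } g/k\in\mathcal{P}\}$$ (quotients are extended analytically to the origin). For an analytic function $\varphi$ on $\mathbb{D}$ with $\varphi(0)=1$ let $\mathcal{S}^*(\varphi)$ be the class of all $f\in\mathcal{A}$ such that $f(z)\neq 0$ for $z\in\mathbb{D}\setminus\{0\}$ and $zf'(z)/f(z)\prec\varphi(z)$, that is, $zf'(z)/f(z)=\varphi(w(z))$ on $\mathbb{D}$ for some analytic $w:\mathbb{D}\to\mathbb{D}$ with $w(0)=0$. For classes $\mathcal{F},\mathcal{G}\subseteq\mathcal{A}$, the $\mathcal{G}$ radius of $\mathcal{F}$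 is the largest number $R\in[0,1]$ such that $r^{-1}f(rz)\in\mathcal{G}$ for all $0<r<R$ and all $f\in\mathcal{F}$. Let $\mathcal{S}^*(\alpha)$, $\mathcal{S}^*_L$, $\mathcal{S}_P$, $\mathcal{S}^*_e$, $\mathcal{S}^*_c$, $\mathcal{S}^*_{\sin}$, $\mathcal{S}^*_{\mathrm{lune}}$, $\mathcal{S}^*_R$ denote $\mathcal{S}^*(\varphi)$ for $\varphi(z)$ equal, respectively, to $$\frac{1+(1-2\alpha)z}{1-z},\quad \sqrt{1+z},\quad 1+\frac{2}{\pi^2}\Big(\log\frac{1+\sqrt z}{1-\sqrt z}\Big)^2,\quad e^z,\quad 1+\tfrac43 z+\tfrac23 z^2,\quad 1+\sin z,\quad z+\sqrt{1+z^2},\quad 1+\frac{\kappa z+z^2}{\kappa^2-\kappa z},$$ where $\kappa=\sqrt2+1$ and the branches are principal. **Theorem.** The following radius results hold for the class $\Pi_1$: 1. for every $0\le\alpha<1$, the $\mathcal{S}^*(\alpha)$ radius is $(1-\alpha)/(3+\sqrt{8+\alpha^2})$; 2. the $\mathcal{S}^*_L$ radius is $(\sqrt2-1)(\sqrt{10}-3)$;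 3. the $\mathcal{S}_P$ radius is $(6-\sqrt{33})/3$; 4. the $\mathcal{S}^*_e$ radius is $(e-1)/(3e+\sqrt{8e^2+1})$; 5. the $\mathcal{S}^*_c$ radius is $(9-\sqrt{73})/4$; 6. the $\mathcal{S}^*_{\sin}$ radius is $\sin 1/\big(\sqrt{9+\sin^2 1+2\sin 1}+3\big)$; 7. the $\mathcal{S}^*_{\mathrm{lune}}$ radius is $3/\sqrt2-\sqrt{\tfrac12(11-2\sqrt2)}$; 8. the $\mathcal{S}^*_R$ radius is $\big(3-2\sqrt{5-2\sqrt2}\big)/(2\sqrt2-1)$. In particular the radius of starlikeness (the $\mathcal{S}^*(0)$ radius) of $\Pi_1$ is $3-2\sqrt2$, and the radius of univalence (the $\mathcal{S}$ radius) of $\Pi_1$ is also $3-2\sqrt2$. In all these cases sharpness is attained by the single function $f_0(z)=z(1+z)^2/(1-z)^4\in\Pi_1$: if $R$ is the radius of $\Pi_1$ for the class $\mathcal{G}$ in question, then $r^{-1}f_0(rz)\notin\mathcal{G}$ for every $R<r\le 1$. -/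

import Mathlib

/-- The open unit disk `𝔻`. -/
def unitDisk : Set ℂ := Metric.ball (0 : ℂ) 1

/-- The class `𝒜` of functions analytic in the unit disk with `f 0 = 0` and `f' 0 = 1`.
Only the values on the unit disk matter. -/
def classA : Set (ℂ → ℂ) :=
  {f | DifferentiableOn ℂ f unitDisk ∧ f 0 = 0 ∧ deriv f 0 = 1}

/-- The class `𝒮` of univalent functions in `𝒜`. -/
def classS : Set (ℂ → ℂ) := {f | f ∈ classA ∧ Set.InjOn f unitDisk}

/-- The class `𝒫` of analytic functions on the unit disk with `p 0 = 1` and positive real part. -/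
def classP : Set (ℂ → ℂ) :=
  {p | DifferentiableOn ℂ p unitDisk ∧ p 0 = 1 ∧ ∀ z ∈ unitDisk, 0 < (p z).re}

/-- `f / g ∈ 𝒫` for two functions that vanish at the origin: the quotient is defined on the
punctured unit disk and extends to a function of the class `𝒫`. -/
def QuotientInP (f g : ℂ → ℂ) : Prop :=
  ∃ p ∈ classP, ∀ z ∈ unitDisk, z ≠ 0 → g z ≠ 0 ∧ f z / g z = p z

/-- The Koebe function. -/
noncomputable def koebe (z : ℂ) : ℂ := z / (1 - z) ^ 2

/-- The class `Π₁`. -/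
def classPi1 : Set (ℂ → ℂ) :=
  {f | f ∈ classA ∧ ∃ g ∈ classA, QuotientInP f g ∧ QuotientInP g koebe}

/-- Subordination `F ≺ φ` in the unit disk: `F = φ ∘ w` for a Schwarz function `w`. -/
def Subordinate (F φ : ℂ → ℂ) : Prop :=
  ∃ w : ℂ → ℂ, DifferentiableOn ℂ w unitDisk ∧ w 0 = 0 ∧ Set.MapsTo w unitDisk unitDisk ∧
    ∀ z ∈ unitDisk, F z = φ (w z)

/-- The function `z f'(z) / f(z)`, with its limit `1` (for `f ∈ 𝒜`) at the origin. -/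
noncomputable def starQuotient (f : ℂ → ℂ) (z : ℂ) : ℂ :=
  if z = 0 then 1 else z * deriv f z / f z

/-- The Ma–Minda class `𝒮*(φ)` of all `f ∈ 𝒜` with `z f'(z) / f(z) ≺ φ(z)`. -/
def starClass (φ : ℂ → ℂ) : Set (ℂ → ℂ) :=
  {f | f ∈ classA ∧ (∀ z ∈ unitDisk, z ≠ 0 → f z ≠ 0) ∧ Subordinate (starQuotient f) φ}

/-- `φ` for the starlike functions of order `α`. -/
noncomputable def phiOrder (α : ℝ) (z : ℂ) : ℂ := (1 + (1 - 2 * (α : ℂ)) * z) / (1 - z)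

/-- `φ` for `𝒮*_L`: the principal branch of `√(1 + z)`. -/
noncomputable def phiL (z : ℂ) : ℂ := (1 + z) ^ (1 / 2 : ℂ)

/-- `φ` for the parabolic starlike functions `𝒮_P`. The value does not depend on
the choice of the square root of `z`. -/
noncomputable def phiP (z : ℂ) : ℂ :=
  1 + 2 / (Real.pi : ℂ) ^ 2 *
    Complex.log ((1 + z ^ (1 / 2 : ℂ)) / (1 - z ^ (1 / 2 : ℂ))) ^ 2

/-- `φ` for `𝒮*_e`. -/
noncomputable def phiE (z : ℂ) : ℂ := Complex.exp z

/-- `φ` for `𝒮*_c` (cardioid). -/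
noncomputable def phiC (z : ℂ) : ℂ := 1 + 4 / 3 * z + 2 / 3 * z ^ 2

/-- `φ` for `𝒮*_sin`. -/
noncomputable def phiSin (z : ℂ) : ℂ := 1 + Complex.sin z

/-- `φ` for the class of the lune. -/
noncomputable def phiLune (z : ℂ) : ℂ := z + (1 + z ^ 2) ^ (1 / 2 : ℂ)

/-- The constant `k = √2 + 1`. -/
noncomputable def kR : ℂ := ((√2 + 1 : ℝ) : ℂ)

/-- `φ` for `𝒮*_R`. -/
noncomputable def phiR (z : ℂ) : ℂ := 1 + (kR * z + z ^ 2) / (kR ^ 2 - kR * z)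

/-- The function `r⁻¹ f(r z)`. -/
noncomputable def dilate (r : ℝ) (f : ℂ → ℂ) (z : ℂ) : ℂ := (r : ℂ)⁻¹ * f ((r : ℂ) * z)

/-- `R` is the `G`-radius of the class `F`: the largest number `R` (at most `1`, as the functions
live on the unit disk) such that `r⁻¹ f(r z)` is in `G` for all `0 < r < R` and all `f ∈ F`. -/
def IsRadius (G F : Set (ℂ → ℂ)) (R : ℝ) : Prop :=
  IsGreatest {ρ : ℝ | 0 ≤ ρ ∧ ρ ≤ 1 ∧ ∀ f ∈ F, ∀ r : ℝ, 0 < r → r < ρ → dilate r f ∈ G} R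

/-- The function `f₀(z) = z (1 + z)² / (1 - z)⁴`. -/
noncomputable def extremalF0 (z : ℂ) : ℂ := z * (1 + z) ^ 2 / (1 - z) ^ 4

/-- `R` is the `G`-radius of `F`, and the single function `f ∈ F` already shows that it
cannot be increased. -/
def IsSharpRadius (G F : Set (ℂ → ℂ)) (R : ℝ) (f : ℂ → ℂ) : Prop :=
  IsRadius G F R ∧ f ∈ F ∧ ∀ r : ℝ, R < r → r ≤ 1 → dilate r f ∉ G

/-! Multiplying the two quotients gives `f = p q k` with `p, q ∈ 𝒫` and `k` the Koebe function, so
`z f'/f = (1+z)/(1-z) + z p'/p + z q'/q`. On `|z| = t` the first term lies on the circle with centre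
`a = (1+t²)/(1-t²)` and radius `2t/(1-t²)`, and Schwarz–Pick bounds each other term by `2t/(1-t²)`.
Hence `z f'/f` lies in the disc with centre `a` and radius `6t/(1-t²)` (`norm_starQuotient_sub_le`).
For `f₀`, where `p = q = (1+z)/(1-z)`, the points `z = ±t` give the two ends of its real diameter
(`starQuotient_extremalF0`).

So the radius for `𝒮*(φ)` is the `t` at which an end of the diameter reaches a real boundary point
`c` of `φ(𝔻)`, provided that the discs have stayed inside until then. The end is the left one with
`c = φ(-1)`, or, for `𝒮*_L` and `𝒮*_sin`, the right one with `c = φ(1)`.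
`isSharpRadius_starClass_left` and `isSharpRadius_starClass_right` leave two facts per class: an
analytic `ω` with `φ ∘ ω = id` maps the discs into `𝔻`, and `φ` omits `c` on `𝔻`. Univalence of `φ`
is not needed.

For univalence, `Re (z f'/f) > 0` up to `3 - 2√2` gives injectivity through the coordinate `log z`,
and beyond that `f₀` repeats a real value, since it has a minimum on the negative axis at `-(3 -
2√2)`. -/

/-! ### Schwarz–Pick bounds for functions with positive real part -/

open Complex ComplexConjugate in
theorem norm_sub_div_add_conj_lt_one {a b : ℂ} (ha : 0 < a.re) (hb : 0 < b.re) :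
    ‖(a - b) / (a + conj b)‖ < 1 := by
  have hne : a + conj b ≠ 0 := by
    intro h
    have := congrArg Complex.re h
    simp at this
    linarith
  rw [norm_div, div_lt_one (norm_pos_iff.2 hne)]
  refine lt_of_pow_lt_pow_left₀ 2 (norm_nonneg _) ?_
  rw [Complex.sq_norm, Complex.sq_norm, Complex.normSq_apply, Complex.normSq_apply]
  simp only [sub_re, sub_im, add_re, add_im, conj_re, conj_im]
  -- The two squared norms differ by `4 Re a Re b`.
  nlinarith [mul_pos ha hb]

open Complex ComplexConjugate in
theorem norm_add_div_one_add_conj_lt_one {a z : ℂ} (ha : ‖a‖ < 1) (hz : ‖z‖ < 1) :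
    1 + conj a * z ≠ 0 ∧ ‖(z + a) / (1 + conj a * z)‖ < 1 := by
  have hne : 1 + conj a * z ≠ 0 := by
    intro h
    have h1 : conj a * z = -1 := by linear_combination h
    have h2 : ‖a‖ * ‖z‖ = 1 := by
      have := congrArg norm h1
      simpa using this
    nlinarith [norm_nonneg a, norm_nonneg z]
  refine ⟨hne, ?_⟩
  rw [norm_div, div_lt_one (norm_pos_iff.2 hne)]
  refine lt_of_pow_lt_pow_left₀ 2 (norm_nonneg _) ?_
  have h1 : ‖a‖ ^ 2 < 1 := by nlinarith [norm_nonneg a]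
  have h2 : ‖z‖ ^ 2 < 1 := by nlinarith [norm_nonneg z]
  rw [Complex.sq_norm, Complex.normSq_apply] at *
  rw [Complex.sq_norm, Complex.normSq_apply] at *
  simp only [mul_re, mul_im, add_re, add_im, conj_re, conj_im, one_re, one_im]
  -- The two squared norms differ by `(1 - |a|²)(1 - |z|²)`.
  nlinarith [mul_pos (sub_pos.2 h1) (sub_pos.2 h2)]

open Complex ComplexConjugate in
/-- The Schwarz–Pick estimate for functions with positive real part. -/
theorem norm_deriv_le_of_re_pos {p : ℂ → ℂ} (hp : DifferentiableOn ℂ p unitDisk)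
    (hre : ∀ z ∈ unitDisk, 0 < (p z).re) {a : ℂ} (ha : ‖a‖ < 1) :
    ‖deriv p a‖ * (1 - ‖a‖ ^ 2) ≤ 2 * (p a).re := by
  have haD : a ∈ unitDisk := by simpa [unitDisk] using ha
  have hopen : IsOpen unitDisk := Metric.isOpen_ball
  set m : ℂ → ℂ := fun z => (z + a) / (1 + conj a * z) with hm
  have hmaps : ∀ z ∈ unitDisk, m z ∈ unitDisk := fun z hz => by
    have hz' : ‖z‖ < 1 := by simpa [unitDisk] using hz
    exact mem_ball_zero_iff.2 (norm_add_div_one_add_conj_lt_one ha hz').2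
  have hmd : ∀ z ∈ unitDisk, DifferentiableAt ℂ m z := fun z hz => by
    have hz' : ‖z‖ < 1 := by simpa [unitDisk] using hz
    exact DifferentiableAt.div (by fun_prop) (by fun_prop)
      (norm_add_div_one_add_conj_lt_one ha hz').1
  have h0D : (0 : ℂ) ∈ unitDisk := by simp [unitDisk]
  have hm0 : m 0 = a := by simp [hm]
  have hpa : 0 < (p a).re := hre a haD
  -- Moving `a` to `0` in the source by `m`, and `p a` to `0` in the target by a map of the
  -- half-plane into the disc, reduces the claim to the Schwarz lemma `|W'(0)| ≤ 1`.
  set W : ℂ → ℂ := fun z => (p (m z) - p a) / (p (m z) + conj (p a)) with hW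
  have hne : ∀ z ∈ unitDisk, p (m z) + conj (p a) ≠ 0 := fun z hz h => by
    have := congrArg Complex.re h
    have h2 := hre _ (hmaps z hz)
    simp at this
    linarith
  have hpm : ∀ z ∈ unitDisk, DifferentiableAt ℂ (fun z => p (m z)) z := fun z hz =>
    DifferentiableAt.comp (g := p) z (hp.differentiableAt (hopen.mem_nhds (hmaps z hz))) (hmd z hz)
  have hWd : DifferentiableOn ℂ W (Metric.ball 0 1) := fun z hz =>
    (DifferentiableAt.div ((hpm z hz).sub_const _) ((hpm z hz).add_const _)
      (hne z hz)).differentiableWithinAt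
  have hW0 : W 0 = 0 := by simp [hW, hm0]
  have hWm : Set.MapsTo W (Metric.ball 0 1) (Metric.closedBall (W 0) 1) := fun z hz => by
    rw [hW0]
    exact mem_closedBall_zero_iff.2 (norm_sub_div_add_conj_lt_one (hre _ (hmaps z hz)) hpa).le
  have hS := Complex.norm_deriv_le_one_of_mapsTo_ball hWd hWm one_pos
  have hmder : HasDerivAt m (1 - conj a * a) 0 := by
    have h1 : HasDerivAt (fun z : ℂ => z + a) 1 0 := (hasDerivAt_id _).add_const _
    have h2 : HasDerivAt (fun z : ℂ => 1 + conj a * z) (conj a) 0 := by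
      simpa using ((hasDerivAt_id (0 : ℂ)).const_mul (conj a)).const_add 1
    refine (h1.fun_div h2 (by simp)).congr_deriv ?_
    simp
    ring
  have hpder : HasDerivAt (fun z => p (m z)) (deriv p a * (1 - conj a * a)) 0 := by
    have h1 : HasDerivAt p (deriv p a) (m 0) := by
      rw [hm0]
      exact (hp.differentiableAt (hopen.mem_nhds haD)).hasDerivAt
    exact h1.comp 0 hmder
  have hsum : p a + conj (p a) ≠ 0 := by simpa [hm0] using hne 0 h0D
  have hWder : HasDerivAt W (deriv p a * (1 - conj a * a) / (p a + conj (p a))) 0 := by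
    refine ((hpder.sub_const (p a)).fun_div (hpder.add_const (conj (p a)))
      (hne 0 h0D)).congr_deriv ?_
    simp only [hm0]
    field_simp
    ring
  rw [hWder.deriv, norm_div, div_le_one (norm_pos_iff.2 hsum), norm_mul] at hS
  have e1 : ‖(1 - conj a * a : ℂ)‖ = 1 - ‖a‖ ^ 2 := by
    rw [← Complex.normSq_eq_conj_mul_self, Complex.normSq_eq_norm_sq, ← Complex.ofReal_one,
      ← Complex.ofReal_sub, Complex.norm_real, Real.norm_eq_abs, abs_of_nonneg]
    nlinarith [norm_nonneg a]
  have e2 : ‖p a + conj (p a)‖ = 2 * (p a).re := by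
    rw [Complex.add_conj, Complex.norm_real, Real.norm_eq_abs, abs_of_pos (by positivity)]
  rwa [e1, e2] at hS

theorem norm_mul_deriv_div_le {p : ℂ → ℂ} (hp : p ∈ classP) {z : ℂ} (hz : ‖z‖ < 1) :
    ‖z * deriv p z / p z‖ ≤ 2 * ‖z‖ / (1 - ‖z‖ ^ 2) := by
  have h1 := norm_deriv_le_of_re_pos hp.1 hp.2.2 hz
  have hzD : z ∈ unitDisk := by simpa [unitDisk] using hz
  have hre := hp.2.2 z hzD
  have hle : (p z).re ≤ ‖p z‖ := Complex.re_le_norm _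
  have hpos : 0 < 1 - ‖z‖ ^ 2 := by nlinarith [norm_nonneg z]
  rw [norm_div, norm_mul, div_le_div_iff₀ (hre.trans_le hle) hpos]
  nlinarith [norm_nonneg z]

open Complex ComplexConjugate in
theorem norm_one_add_div_one_sub_sub {z : ℂ} (hz : ‖z‖ < 1) :
    ‖(1 + z) / (1 - z) - (((1 + ‖z‖ ^ 2) / (1 - ‖z‖ ^ 2) : ℝ) : ℂ)‖
      = 2 * ‖z‖ / (1 - ‖z‖ ^ 2) := by
  have hpos : 0 < 1 - ‖z‖ ^ 2 := by nlinarith [norm_nonneg z]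
  have hne : (1 : ℂ) - z ≠ 0 := by
    intro h
    have : z = 1 := by linear_combination -h
    simp [this] at hz
  have hne' : (1 : ℂ) - (‖z‖ : ℂ) ^ 2 ≠ 0 := by
    have := hpos.ne'
    exact_mod_cast this
  have hcz : z * conj z = (‖z‖ : ℂ) ^ 2 := Complex.mul_conj' z
  -- In this form the factors `1 - z` and `conj (1 - z)` have the same modulus and cancel.
  have key : (1 + z) / (1 - z) - (((1 + ‖z‖ ^ 2) / (1 - ‖z‖ ^ 2) : ℝ) : ℂ)
      = 2 * z * conj (1 - z) / ((1 - z) * ((1 - ‖z‖ ^ 2 : ℝ) : ℂ)) := by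
    push_cast
    rw [div_sub_div _ _ hne hne']
    congr 1
    simp only [map_sub, map_one]
    linear_combination (-2) * (-hcz)
  rw [key, norm_div, norm_mul, norm_mul, norm_mul, Complex.norm_conj, Complex.norm_real,
    Real.norm_eq_abs, abs_of_pos hpos]
  have := norm_pos_iff.2 hne
  simp
  field_simp

/-! ### The values of `z f'(z) / f(z)` on `Π₁` -/

theorem classPi1_exists_eq {f : ℂ → ℂ} (hf : f ∈ classPi1) :
    ∃ p ∈ classP, ∃ q ∈ classP, ∀ z ∈ unitDisk, f z = p z * q z * (z / (1 - z) ^ 2) := by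
  obtain ⟨hfA, g, hgA, ⟨p, hp, hfg⟩, q, hq, hgk⟩ := hf
  refine ⟨p, hp, q, hq, fun z hz => ?_⟩
  rcases eq_or_ne z 0 with rfl | h0
  · simp [hfA.2.1]
  · obtain ⟨hg, e1⟩ := hfg z hz h0
    obtain ⟨hk, e2⟩ := hgk z hz h0
    rw [div_eq_iff hg] at e1
    rw [div_eq_iff hk] at e2
    rw [e1, e2, koebe]
    ring

theorem one_sub_ne_zero_of_mem_unitDisk {z : ℂ} (hz : z ∈ unitDisk) : 1 - z ≠ 0 := by
  intro h
  have : z = 1 := by linear_combination -h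
  simp [this, unitDisk] at hz

theorem classP_ne_zero {p : ℂ → ℂ} (hp : p ∈ classP) {z : ℂ} (hz : z ∈ unitDisk) : p z ≠ 0 := by
  intro h
  have := hp.2.2 z hz
  simp [h] at this

theorem classP_hasDerivAt {p : ℂ → ℂ} (hp : p ∈ classP) {z : ℂ} (hz : z ∈ unitDisk) :
    HasDerivAt p (deriv p z) z :=
  (hp.1.differentiableAt (Metric.isOpen_ball.mem_nhds hz)).hasDerivAt

/-- Logarithmic differentiation of `p q k`; the Koebe factor contributes `z k'/k = (1+z)/(1-z)`. -/
theorem starQuotient_eq {f p q : ℂ → ℂ} (hp : p ∈ classP) (hq : q ∈ classP)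
    (hf : ∀ z ∈ unitDisk, f z = p z * q z * (z / (1 - z) ^ 2)) {z : ℂ} (hz : z ∈ unitDisk) :
    starQuotient f z = (1 + z) / (1 - z) + z * deriv p z / p z + z * deriv q z / q z := by
  rcases eq_or_ne z 0 with rfl | h0
  · simp [starQuotient]
  have h1 := one_sub_ne_zero_of_mem_unitDisk hz
  have hp0 := classP_ne_zero hp hz
  have hq0 := classP_ne_zero hq hz
  have hfe : f =ᶠ[nhds z] fun z => p z * q z * (z / (1 - z) ^ 2) := by
    filter_upwards [Metric.isOpen_ball.mem_nhds hz] with y hy using hf y hy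
  have hk : HasDerivAt (fun z : ℂ => z / (1 - z) ^ 2)
      ((1 * (1 - z) ^ 2 - z * (2 * (1 - z) ^ 1 * (-1))) / ((1 - z) ^ 2) ^ 2) z := by
    have h2 : HasDerivAt (fun z : ℂ => 1 - z) (-1) z := (hasDerivAt_id z).const_sub 1
    exact (hasDerivAt_id z).fun_div (by simpa using h2.fun_pow 2) (pow_ne_zero 2 h1)
  have hd := ((classP_hasDerivAt hp hz).mul (classP_hasDerivAt hq hz)).mul hk
  have hd' : deriv f z = _ := hfe.deriv_eq.trans hd.deriv
  rw [starQuotient, if_neg h0, hd', hf z hz]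
  simp only [Pi.mul_apply]
  field_simp
  ring

theorem norm_starQuotient_sub_le {f : ℂ → ℂ} (hf : f ∈ classPi1) {z : ℂ} (hz : ‖z‖ < 1) :
    ‖starQuotient f z - (((1 + ‖z‖ ^ 2) / (1 - ‖z‖ ^ 2) : ℝ) : ℂ)‖
      ≤ 6 * ‖z‖ / (1 - ‖z‖ ^ 2) := by
  obtain ⟨p, hp, q, hq, h⟩ := classPi1_exists_eq hf
  have hzD : z ∈ unitDisk := by simpa [unitDisk] using hz
  rw [starQuotient_eq hp hq h hzD]
  have h1 := norm_mul_deriv_div_le hp hz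
  have h2 := norm_mul_deriv_div_le hq hz
  have h3 := norm_one_add_div_one_sub_sub hz
  set c : ℂ := (((1 + ‖z‖ ^ 2) / (1 - ‖z‖ ^ 2) : ℝ) : ℂ)
  calc _ = ‖((1 + z) / (1 - z) - c) + z * deriv p z / p z + z * deriv q z / q z‖ := by
        congr 1; ring
    _ ≤ ‖(1 + z) / (1 - z) - c‖ + ‖z * deriv p z / p z‖ + ‖z * deriv q z / q z‖ := norm_add₃_le
    _ ≤ 2 * ‖z‖ / (1 - ‖z‖ ^ 2) + 2 * ‖z‖ / (1 - ‖z‖ ^ 2) + 2 * ‖z‖ / (1 - ‖z‖ ^ 2) := by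
        gcongr
        exact h3.le
    _ = _ := by ring

theorem differentiableAt_starQuotient {f : ℂ → ℂ} (hf : f ∈ classPi1) {z : ℂ}
    (hz : z ∈ unitDisk) : DifferentiableAt ℂ (starQuotient f) z := by
  obtain ⟨p, hp, q, hq, h⟩ := classPi1_exists_eq hf
  have he : starQuotient f =ᶠ[nhds z]
      fun z => (1 + z) / (1 - z) + z * deriv p z / p z + z * deriv q z / q z := by
    filter_upwards [Metric.isOpen_ball.mem_nhds hz] with y hy using starQuotient_eq hp hq h hy
  refine DifferentiableAt.congr_of_eventuallyEq ?_ he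
  have hD := Metric.isOpen_ball.mem_nhds hz
  have h1 := one_sub_ne_zero_of_mem_unitDisk hz
  have hp1 := hp.1.differentiableAt hD
  have hq1 := hq.1.differentiableAt hD
  have hp2 := (hp.1.deriv Metric.isOpen_ball).differentiableAt hD
  have hq2 := (hq.1.deriv Metric.isOpen_ball).differentiableAt hD
  refine DifferentiableAt.add (DifferentiableAt.add ?_ ?_) ?_
  · exact DifferentiableAt.div (by fun_prop) (by fun_prop) h1
  · exact DifferentiableAt.div (differentiableAt_id.mul hp2) hp1 (classP_ne_zero hp hz)
  · exact DifferentiableAt.div (differentiableAt_id.mul hq2) hq1 (classP_ne_zero hq hz)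

theorem classPi1_ne_zero {f : ℂ → ℂ} (hf : f ∈ classPi1) {z : ℂ} (hz : z ∈ unitDisk)
    (h0 : z ≠ 0) : f z ≠ 0 := by
  obtain ⟨p, hp, q, hq, h⟩ := classPi1_exists_eq hf
  rw [h z hz]
  exact mul_ne_zero (mul_ne_zero (classP_ne_zero hp hz) (classP_ne_zero hq hz))
    (div_ne_zero h0 (pow_ne_zero 2 (one_sub_ne_zero_of_mem_unitDisk hz)))

/-! ### Dilations and subordination -/

theorem deriv_dilate {r : ℝ} (hr : r ≠ 0) (f : ℂ → ℂ) (z : ℂ) :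
    deriv (dilate r f) z = deriv f (r * z) := by
  have : (r : ℂ) ≠ 0 := by exact_mod_cast hr
  change deriv (fun z => (r : ℂ)⁻¹ * f ((r : ℂ) * z)) z = _
  rw [deriv_const_mul_field, deriv_comp_mul_left]
  simp [this]

theorem starQuotient_dilate {r : ℝ} (hr : r ≠ 0) (f : ℂ → ℂ) (z : ℂ) :
    starQuotient (dilate r f) z = starQuotient f (r * z) := by
  have hr' : (r : ℂ) ≠ 0 := by exact_mod_cast hr
  rcases eq_or_ne z 0 with rfl | h0
  · simp [starQuotient]
  · rw [starQuotient, starQuotient, if_neg h0, if_neg (mul_ne_zero hr' h0), deriv_dilate hr, dilate]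
    field_simp

theorem ofReal_mul_mem_unitDisk {r : ℝ} (hr : 0 < r) (hr1 : r ≤ 1) {z : ℂ} (hz : z ∈ unitDisk) :
    (r : ℂ) * z ∈ unitDisk := by
  simp only [unitDisk, mem_ball_zero_iff, norm_mul, Complex.norm_real, Real.norm_eq_abs,
    abs_of_pos hr] at *
  nlinarith [norm_nonneg z]

theorem dilate_mem_classA {r : ℝ} (hr : 0 < r) (hr1 : r ≤ 1) {f : ℂ → ℂ} (hf : f ∈ classA) :
    dilate r f ∈ classA := by
  refine ⟨fun z hz => ?_, by simp [dilate, hf.2.1], by simp [deriv_dilate hr.ne', hf.2.2]⟩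
  have h := hf.1.differentiableAt (Metric.isOpen_ball.mem_nhds (ofReal_mul_mem_unitDisk hr hr1 hz))
  refine DifferentiableAt.differentiableWithinAt ?_
  change DifferentiableAt ℂ (fun z => (r : ℂ)⁻¹ * f ((r : ℂ) * z)) z
  refine DifferentiableAt.const_mul ?_ _
  exact DifferentiableAt.comp (g := f) z h (by fun_prop)

/-- A left inverse `ω` of `φ` on the discs that contain the values of `z f'(z) / f(z)`. -/
theorem dilate_mem_starClass {φ ω : ℂ → ℂ} {R : ℝ} (hR : R ≤ 1) (hω : ω 1 = 0)
    (H : ∀ (t : ℝ) (F : ℂ), 0 ≤ t → t < R →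
      ‖F - (((1 + t ^ 2) / (1 - t ^ 2) : ℝ) : ℂ)‖ ≤ 6 * t / (1 - t ^ 2) →
      DifferentiableAt ℂ ω F ∧ ‖ω F‖ < 1 ∧ φ (ω F) = F)
    {f : ℂ → ℂ} (hf : f ∈ classPi1) {r : ℝ} (hr : 0 < r) (hrR : r < R) :
    dilate r f ∈ starClass φ := by
  have hr1 : r ≤ 1 := hrR.le.trans hR
  have hr' : (r : ℂ) ≠ 0 := by exact_mod_cast hr.ne'
  have hD : ∀ z ∈ unitDisk, (r : ℂ) * z ∈ unitDisk := fun z => ofReal_mul_mem_unitDisk hr hr1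
  have hval : ∀ z ∈ unitDisk, DifferentiableAt ℂ ω (starQuotient f (r * z)) ∧
      ‖ω (starQuotient f (r * z))‖ < 1 ∧
      φ (ω (starQuotient f (r * z))) = starQuotient f (r * z) := fun z hz => by
    have h1 : ‖(r : ℂ) * z‖ < 1 := by simpa [unitDisk] using hD z hz
    have h2 : ‖(r : ℂ) * z‖ < R := by
      have : ‖z‖ < 1 := by simpa [unitDisk] using hz
      rw [norm_mul, Complex.norm_real, Real.norm_eq_abs, abs_of_pos hr]
      nlinarith [norm_nonneg z]
    exact H _ _ (norm_nonneg _) h2 (norm_starQuotient_sub_le hf h1)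
  -- The Schwarz function is `ω` composed with `z f'/f` at `r z`; it vanishes at the origin because
  -- `z f'/f` is `1` there and `ω 1 = 0`.
  refine ⟨dilate_mem_classA hr hr1 hf.1, fun z hz h0 => ?_, fun z => ω (starQuotient f (r * z)),
    fun z hz => ?_, ?_, fun z hz => ?_, fun z hz => ?_⟩
  · exact mul_ne_zero (inv_ne_zero hr') (classPi1_ne_zero hf (hD z hz) (mul_ne_zero hr' h0))
  · refine DifferentiableAt.differentiableWithinAt ?_
    refine DifferentiableAt.comp (g := ω) z (hval z hz).1 ?_
    exact DifferentiableAt.comp (g := starQuotient f) z (differentiableAt_starQuotient hf (hD z hz))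
      (by fun_prop)
  · simp [starQuotient, hω]
  · simpa [unitDisk] using (hval z hz).2.1
  · simp only
    rw [starQuotient_dilate hr.ne', (hval z hz).2.2]

/-! ### The extremal function -/

/-- The extremal function `(1 + z) / (1 - z)` of the class `𝒫`. -/
noncomputable def cayley (z : ℂ) : ℂ := (1 + z) / (1 - z)

theorem differentiableOn_cayley : DifferentiableOn ℂ cayley unitDisk := fun z hz =>
  (DifferentiableAt.div (by fun_prop) (by fun_prop)
    (one_sub_ne_zero_of_mem_unitDisk hz)).differentiableWithinAt

theorem cayley_mem_classP : cayley ∈ classP := by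
  refine ⟨differentiableOn_cayley, by simp [cayley], fun z hz => ?_⟩
  have h1 := one_sub_ne_zero_of_mem_unitDisk hz
  have hz' : ‖z‖ ^ 2 < 1 := by
    have : ‖z‖ < 1 := by simpa [unitDisk] using hz
    nlinarith [norm_nonneg z]
  rw [Complex.sq_norm, Complex.normSq_apply] at hz'
  rw [cayley, Complex.div_re, ← add_div]
  refine div_pos ?_ (Complex.normSq_pos.2 h1)
  simp
  nlinarith

theorem hasDerivAt_cayley {z : ℂ} (hz : z ∈ unitDisk) :
    HasDerivAt cayley (2 / (1 - z) ^ 2) z := by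
  have h1 := one_sub_ne_zero_of_mem_unitDisk hz
  refine (((hasDerivAt_id z).const_add 1).fun_div ((hasDerivAt_id z).const_sub 1)
    h1).congr_deriv ?_
  simp only [id]
  field_simp
  ring

theorem id_mul_mem_classA {h : ℂ → ℂ} (hd : DifferentiableOn ℂ h unitDisk) (h0 : h 0 = 1) :
    (fun z => z * h z) ∈ classA := by
  refine ⟨differentiableOn_id.mul hd, by simp, ?_⟩
  have h1 : HasDerivAt h (deriv h 0) 0 :=
    (hd.differentiableAt (Metric.isOpen_ball.mem_nhds (by simp))).hasDerivAt
  have := (hasDerivAt_id (0 : ℂ)).fun_mul h1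
  exact this.deriv.trans (by simp [h0])

theorem extremalF0_eq {z : ℂ} (hz : z ∈ unitDisk) :
    extremalF0 z = cayley z * cayley z * (z / (1 - z) ^ 2) := by
  have h1 := one_sub_ne_zero_of_mem_unitDisk hz
  rw [extremalF0, cayley]
  field_simp

theorem extremalF0_mem_classPi1 : extremalF0 ∈ classPi1 := by
  have e1 : extremalF0 = fun z => z * ((1 + z) ^ 2 / (1 - z) ^ 4) := by
    funext z; rw [extremalF0, mul_div_assoc]
  have hd : ∀ (m n : ℕ), DifferentiableOn ℂ (fun z : ℂ => (1 + z) ^ m / (1 - z) ^ n) unitDisk :=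
    fun m n => DifferentiableOn.fun_div (by fun_prop) (by fun_prop) fun z hz =>
      pow_ne_zero n (one_sub_ne_zero_of_mem_unitDisk hz)
  have hne : ∀ z ∈ unitDisk, 1 + z ≠ 0 := fun z hz h => by
    have : z = -1 := by linear_combination h
    simp [this, unitDisk] at hz
  refine ⟨e1 ▸ id_mul_mem_classA (hd 2 4) (by simp), fun z => z * ((1 + z) ^ 1 / (1 - z) ^ 3),
    id_mul_mem_classA (hd 1 3) (by simp), ⟨cayley, cayley_mem_classP, fun z hz h0 => ?_⟩,
    cayley, cayley_mem_classP, fun z hz h0 => ?_⟩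
  · have h1 := one_sub_ne_zero_of_mem_unitDisk hz
    have h2 := hne z hz
    refine ⟨mul_ne_zero h0 (div_ne_zero (pow_ne_zero _ h2) (pow_ne_zero _ h1)), ?_⟩
    rw [extremalF0, cayley]
    field_simp
  · have h1 := one_sub_ne_zero_of_mem_unitDisk hz
    refine ⟨div_ne_zero h0 (pow_ne_zero _ h1), ?_⟩
    rw [koebe, cayley]
    field_simp

/-- For positive `x` this is the right end of the diameter of the disc in
`norm_starQuotient_sub_le`, for negative `x` the left end. -/
theorem starQuotient_extremalF0 {x : ℝ} (hx : |x| < 1) :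
    starQuotient extremalF0 x = (((1 + 6 * x + x ^ 2) / (1 - x ^ 2) : ℝ) : ℂ) := by
  have hD : (x : ℂ) ∈ unitDisk := by simpa [unitDisk] using hx
  rw [starQuotient_eq cayley_mem_classP cayley_mem_classP (fun z => extremalF0_eq) hD,
    (hasDerivAt_cayley hD).deriv, cayley]
  have h1 : (1 - x) ≠ 0 := by linarith [(abs_lt.1 hx).2]
  have h2 : (1 + x) ≠ 0 := by linarith [(abs_lt.1 hx).1]
  have h3 : 1 - x ^ 2 ≠ 0 := by
    rw [show 1 - x ^ 2 = (1 - x) * (1 + x) by ring]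
    exact mul_ne_zero h1 h2
  norm_cast
  have e : ((1 + x) / (1 - x) + x * (2 / (1 - x) ^ 2) / ((1 + x) / (1 - x)) +
      x * (2 / (1 - x) ^ 2) / ((1 + x) / (1 - x))) = (1 + 6 * x + x ^ 2) / (1 - x ^ 2) := by
    rw [show 1 - x ^ 2 = (1 - x) * (1 + x) by ring]
    field_simp
    ring
  exact_mod_cast congrArg (fun y : ℝ => (y : ℂ)) e

/-! ### Criteria for a sharp radius -/

theorem isSharpRadius_of {G F : Set (ℂ → ℂ)} {R : ℝ} {f : ℂ → ℂ} (h0 : 0 ≤ R) (h1 : R < 1)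
    (hG : ∀ f ∈ F, ∀ r : ℝ, 0 < r → r < R → dilate r f ∈ G) (hf : f ∈ F)
    (hs : ∀ r : ℝ, R < r → r ≤ 1 → dilate r f ∉ G) : IsSharpRadius G F R f := by
  refine ⟨⟨⟨h0, h1.le, hG⟩, fun ρ ⟨_, hρ1, hρ⟩ => ?_⟩, hf, hs⟩
  by_contra! hlt
  obtain ⟨r, hr1, hr2⟩ := exists_between hlt
  exact hs r hr1 (hr2.le.trans hρ1) (hρ f hf r (h0.trans_lt hr1) hr2)

/-- For `r > R` the point `x / r` is inside the disc, and there the dilated function takes a value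
of `z f'/f` that `φ` omits. -/
theorem dilate_extremalF0_notMem_starClass {φ : ℂ → ℂ} {R x : ℝ} (hR : 0 < R) (hx : |x| = R)
    (hφ : ∀ w ∈ unitDisk, φ w ≠ (((1 + 6 * x + x ^ 2) / (1 - x ^ 2) : ℝ) : ℂ))
    {r : ℝ} (hr : R < r) (hr1 : r ≤ 1) : dilate r extremalF0 ∉ starClass φ := by
  rintro ⟨-, -, w, -, -, hw, hF⟩
  have hr0 : 0 < r := hR.trans hr
  have hD : ((x / r : ℝ) : ℂ) ∈ unitDisk := by
    rw [unitDisk, mem_ball_zero_iff, Complex.norm_real, Real.norm_eq_abs, abs_div, hx,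
      abs_of_pos hr0, div_lt_one hr0]
    exact hr
  have := hF _ hD
  rw [starQuotient_dilate hr0.ne', ← Complex.ofReal_mul, mul_div_cancel₀ _ hr0.ne',
    starQuotient_extremalF0 (by linarith)] at this
  exact hφ _ (hw hD) this.symm

/-- The case in which the discs that contain the values of `z f'(z) / f(z)` first leave the
image of `φ` at the point `c` on the left. -/
theorem isSharpRadius_starClass_left {φ ω : ℂ → ℂ} {R c : ℝ} (hR0 : 0 < R) (hR1 : R < 1)
    (hc0 : 0 ≤ c) (hc1 : c ≤ 1) (hRc : 1 - 6 * R + R ^ 2 = c * (1 - R ^ 2)) (hω : ω 1 = 0)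
    (H : ∀ (a : ℝ) (F : ℂ), 1 ≤ a → a ≤ 5 / 4 → ‖F - a‖ < a - c →
      DifferentiableAt ℂ ω F ∧ ‖ω F‖ < 1 ∧ φ (ω F) = F)
    (hφ : ∀ w ∈ unitDisk, φ w ≠ c) :
    IsSharpRadius (starClass φ) classPi1 R extremalF0 := by
  -- Since `c ≥ 0`, the equation for `R` forces `1 - 6R + R² ≥ 0`. The bound `1/3` is what makes
  -- every centre `(1+t²)/(1-t²)` at most `5/4`.
  have hR3 : R < 1 / 3 := by
    by_contra! h
    nlinarith [mul_nonneg hc0 (show 0 ≤ 1 - R ^ 2 by nlinarith)]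
  refine isSharpRadius_of hR0.le hR1 (fun f hf r hr hrR =>
    dilate_mem_starClass hR1.le hω (fun t F ht htR hF => ?_) hf hr hrR) extremalF0_mem_classPi1
    fun r hr hr1 => dilate_extremalF0_notMem_starClass (x := -R) hR0 (by simp [hR0.le])
      (fun w hw => ?_) hr hr1
  · have ht2 : 0 < 1 - t ^ 2 := by nlinarith
    refine H _ F ?_ ?_ (hF.trans_lt ?_)
    · rw [le_div_iff₀ ht2]
      nlinarith
    · rw [div_le_iff₀ ht2]
      nlinarith
    · rw [lt_sub_iff_add_lt', ← lt_sub_iff_add_lt, ← sub_div, lt_div_iff₀ ht2]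
      -- `1 - 6t + t² - c(1 - t²)` vanishes at `t = R` and factors as `(R - t)(6 - (1+c)(R+t))`.
      nlinarith [mul_pos (sub_pos.2 htR) (show 0 < 6 - (1 + c) * (R + t) by nlinarith)]
  · have hR2 : 1 - R ^ 2 ≠ 0 := by nlinarith
    have : (1 + 6 * -R + (-R) ^ 2) / (1 - (-R) ^ 2) = c := by
      rw [neg_sq, div_eq_iff hR2, ← hRc]
      ring
    rw [this]
    exact hφ w hw

/-- The case in which the discs that contain the values of `z f'(z) / f(z)` first leave the
image of `φ` at the point `c` on the right. -/
theorem isSharpRadius_starClass_right {φ ω : ℂ → ℂ} {R c : ℝ} (hR0 : 0 < R) (hR1 : R < 1)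
    (hc0 : 0 ≤ c) (hRc : 1 + 6 * R + R ^ 2 = c * (1 - R ^ 2)) (hω : ω 1 = 0)
    (H : ∀ (a : ℝ) (F : ℂ), 1 ≤ a → ‖F - a‖ < c - a →
      DifferentiableAt ℂ ω F ∧ ‖ω F‖ < 1 ∧ φ (ω F) = F)
    (hφ : ∀ w ∈ unitDisk, φ w ≠ c) :
    IsSharpRadius (starClass φ) classPi1 R extremalF0 := by
  refine isSharpRadius_of hR0.le hR1 (fun f hf r hr hrR =>
    dilate_mem_starClass hR1.le hω (fun t F ht htR hF => ?_) hf hr hrR) extremalF0_mem_classPi1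
    fun r hr hr1 => dilate_extremalF0_notMem_starClass (x := R) hR0 (by simp [hR0.le])
      (fun w hw => ?_) hr hr1
  · have ht2 : 0 < 1 - t ^ 2 := by nlinarith
    refine H _ F ?_ (hF.trans_lt ?_)
    · rw [le_div_iff₀ ht2]
      nlinarith
    · rw [lt_sub_iff_add_lt, ← add_div, div_lt_iff₀ ht2]
      nlinarith [mul_pos (sub_pos.2 htR) (show 0 < 6 + (1 + c) * (R + t) by nlinarith)]
  · have hR2 : 1 - R ^ 2 ≠ 0 := by nlinarith
    have : (1 + 6 * R + R ^ 2) / (1 - R ^ 2) = c := by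
      rw [div_eq_iff hR2, ← hRc]
    rw [this]
    exact hφ w hw

/-! ### The radius of univalence -/

/-- The Noshiro–Warschawski criterion. -/
theorem injOn_of_re_deriv_pos {s : Set ℂ} (hs : Convex ℝ s) {U U' : ℂ → ℂ}
    (hU : ∀ z ∈ s, HasDerivAt U (U' z) z) (hre : ∀ z ∈ s, 0 < (U' z).re) : Set.InjOn U s := by
  intro a ha b hb hab
  by_contra hne
  set d : ℂ := b - a with hd
  have hd0 : d ≠ 0 := sub_ne_zero.2 (Ne.symm hne)
  have hmem : ∀ t ∈ Set.Icc (0 : ℝ) 1, a + t * d ∈ s := fun t ht => by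
    have := hs.add_smul_sub_mem ha hb ht
    simpa using this
  -- After multiplication by `conj d`, the derivative along the segment has real part `|d|² Re U' >
  -- 0`.
  have hder : ∀ t ∈ Set.Icc (0 : ℝ) 1, HasDerivAt
      (fun t : ℝ => (starRingEnd ℂ d * U (a + t * d)).re)
      (Complex.normSq d * (U' (a + t * d)).re) t := fun t ht => by
    have h1 : HasDerivAt (fun z : ℂ => a + z * d) d (t : ℂ) := by
      simpa using ((hasDerivAt_id (t : ℂ)).mul_const d).const_add a
    have h2 := ((HasDerivAt.comp (t : ℂ) (hU _ (hmem t ht)) h1).const_mul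
      (starRingEnd ℂ d)).real_of_complex
    refine h2.congr_deriv ?_
    rw [show starRingEnd ℂ d * (U' (a + t * d) * d) = (Complex.normSq d : ℂ) * U' (a + t * d) by
      rw [Complex.normSq_eq_conj_mul_self]; ring, Complex.re_ofReal_mul]
  have hmono : StrictMonoOn (fun t : ℝ => (starRingEnd ℂ d * U (a + t * d)).re)
      (Set.Icc 0 1) := by
    refine strictMonoOn_of_deriv_pos (convex_Icc 0 1)
      (fun t ht => (hder t ht).continuousAt.continuousWithinAt) fun t ht => ?_
    have ht' := interior_subset ht
    rw [(hder t ht').deriv]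
    exact mul_pos (Complex.normSq_pos.2 hd0) (hre _ (hmem t ht'))
  have := hmono (by simp) (by simp) (zero_lt_one' ℝ)
  simp [hd, hab] at this

/-- In the coordinate `z = exp ζ`, the function `U(ζ) = log f(exp ζ)` has derivative `z f'/f`, so it
is injective on a left half-plane by Noshiro–Warschawski. If `f a = f b`, the values of `U` at `log
a` and `log b` differ by `2πin`; since `U(ζ + 2πin) = U(ζ) + 2πin`, so do `log a` and `log b`. -/
theorem injOn_of_re_starQuotient_pos {f : ℂ → ℂ} (hf : f ∈ classPi1) {R : ℝ} (hR : R ≤ 1)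
    (hre : ∀ z : ℂ, ‖z‖ < R → 0 < (starQuotient f z).re) :
    Set.InjOn f (Metric.ball 0 R) := by
  obtain ⟨p, hp, q, hq, h⟩ := classPi1_exists_eq hf
  have hsub : ∀ z ∈ Metric.ball (0 : ℂ) R, z ∈ unitDisk := fun z hz =>
    Metric.ball_subset_ball hR hz
  have hzero : ∀ z ∈ Metric.ball (0 : ℂ) R, f z = 0 → z = 0 := fun z hz hfz => by
    by_contra h0
    exact classPi1_ne_zero hf (hsub z hz) h0 hfz
  intro a ha b hb hab
  by_cases ha0 : a = 0
  · rw [ha0, hf.1.2.1] at hab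
    rw [ha0, hzero b hb hab.symm]
  by_cases hb0 : b = 0
  · rw [hb0, hf.1.2.1] at hab
    rw [hb0, hzero a ha hab]
  have hRpos : 0 < R := (norm_nonneg a).trans_lt (mem_ball_zero_iff.1 ha)
  set s : Set ℂ := {z | z.re < Real.log R} with hs
  have hexp : ∀ z ∈ s, Complex.exp z ∈ Metric.ball (0 : ℂ) R := fun z hz => by
    rw [mem_ball_zero_iff, Complex.norm_exp]
    exact (Real.lt_log_iff_exp_lt hRpos).1 hz
  have hlog : ∀ z ∈ Metric.ball (0 : ℂ) R, z ≠ 0 → Complex.log z ∈ s := fun z hz h0 => by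
    change (Complex.log z).re < _
    rw [Complex.log_re]
    exact Real.log_lt_log (norm_pos_iff.2 h0) (mem_ball_zero_iff.1 hz)
  -- `p`, `q` and `1 - z` take values in the right half-plane, so principal logarithms give an
  -- analytic branch of `log f(exp ζ)`.
  set U : ℂ → ℂ := fun z => z + Complex.log (p (Complex.exp z)) + Complex.log (q (Complex.exp z))
    - 2 * Complex.log (1 - Complex.exp z) with hU
  have hre1 : ∀ z ∈ unitDisk, 0 < (1 - z).re := fun z hz => by
    have : ‖z‖ < 1 := by simpa [unitDisk] using hz
    have := Complex.re_le_norm z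
    simp
    linarith
  have hUder : ∀ z ∈ s, HasDerivAt U (starQuotient f (Complex.exp z)) z := fun z hz => by
    have hD := hsub _ (hexp z hz)
    have he := Complex.hasDerivAt_exp z
    have h1 := ((classP_hasDerivAt hp hD).comp z he).clog (Or.inl (hp.2.2 _ hD))
    have h2 := ((classP_hasDerivAt hq hD).comp z he).clog (Or.inl (hq.2.2 _ hD))
    have h3 := (he.const_sub 1).clog (Or.inl (hre1 _ hD))
    refine ((((hasDerivAt_id z).add h1).add h2).sub (h3.const_mul 2)).congr_deriv ?_
    rw [starQuotient_eq hp hq h hD]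
    have h4 := one_sub_ne_zero_of_mem_unitDisk hD
    simp only [Function.comp_apply]
    field_simp
    ring
  have hUexp : ∀ z ∈ s, Complex.exp (U z) = f (Complex.exp z) := fun z hz => by
    have hD := hsub _ (hexp z hz)
    have h4 := one_sub_ne_zero_of_mem_unitDisk hD
    rw [h _ hD, hU]
    simp only
    rw [Complex.exp_sub, Complex.exp_add, Complex.exp_add, Complex.exp_log (classP_ne_zero hp hD),
      Complex.exp_log (classP_ne_zero hq hD), two_mul, Complex.exp_add, Complex.exp_log h4]
    field_simp
  have hinj : Set.InjOn U s := injOn_of_re_deriv_pos (convex_halfSpace_re_lt _) hUder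
    fun z hz => hre _ (mem_ball_zero_iff.1 (hexp z hz))
  have hla := hlog a ha ha0
  have hlb := hlog b hb hb0
  have hee : Complex.exp (U (Complex.log a)) = Complex.exp (U (Complex.log b)) := by
    rw [hUexp _ hla, hUexp _ hlb, Complex.exp_log ha0, Complex.exp_log hb0, hab]
  obtain ⟨n, hn⟩ := Complex.exp_eq_exp_iff_exists_int.1 hee
  have hper : Complex.exp (Complex.log b + n * (2 * Real.pi * Complex.I))
      = Complex.exp (Complex.log b) := Complex.exp_eq_exp_iff_exists_int.2 ⟨n, rfl⟩
  have hUper : U (Complex.log a) = U (Complex.log b + n * (2 * Real.pi * Complex.I)) := by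
    rw [hn]
    simp only [hU, hper]
    ring
  have hmem : Complex.log b + n * (2 * Real.pi * Complex.I) ∈ s := by
    have : (Complex.log b).re < Real.log R := hlb
    simpa [hs] using this
  have := hinj hla hmem hUper
  rw [← Complex.exp_log ha0, this, hper, Complex.exp_log hb0]

theorem isSharpRadius_classS : IsSharpRadius classS classPi1 (3 - 2 * √2) extremalF0 := by
  have h2 : √2 ^ 2 = 2 := Real.sq_sqrt (by norm_num)
  have h2l : 1.41 < √2 := Real.lt_sqrt_of_sq_lt (by norm_num)
  have h2u : √2 < 1.42 := (Real.sqrt_lt' (by norm_num)).2 (by norm_num)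
  set R : ℝ := 3 - 2 * √2 with hR
  have hR0 : 0 < R := by rw [hR]; linarith
  have hR1 : R < 1 := by rw [hR]; linarith
  have hRq : 1 - 6 * R + R ^ 2 = 0 := by rw [hR]; nlinarith
  refine isSharpRadius_of hR0.le hR1 (fun f hf r hr hrR => ⟨dilate_mem_classA hr
    (hrR.le.trans hR1.le) hf.1, ?_⟩) extremalF0_mem_classPi1 fun r hr hr1 hS => ?_
  · have hr' : (r : ℂ) ≠ 0 := by exact_mod_cast hr.ne'
    have hinj := injOn_of_re_starQuotient_pos hf hR1.le fun z hz => by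
      have h1 := norm_starQuotient_sub_le hf (hz.trans hR1)
      have h3 := (Complex.abs_re_le_norm _).trans h1
      rw [Complex.sub_re, Complex.ofReal_re, abs_le] at h3
      have hpos : 0 < 1 - ‖z‖ ^ 2 := by nlinarith [norm_nonneg z]
      have h4 : 6 * ‖z‖ / (1 - ‖z‖ ^ 2) < (1 + ‖z‖ ^ 2) / (1 - ‖z‖ ^ 2) := by
        gcongr
        nlinarith [norm_nonneg z, mul_pos (sub_pos.2 hz) (show 0 < 6 - (R + ‖z‖) by linarith)]
      linarith [h3.1]
    have hmem : ∀ z ∈ unitDisk, (r : ℂ) * z ∈ Metric.ball (0 : ℂ) R := fun z hz => by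
      have : ‖z‖ < 1 := by simpa [unitDisk] using hz
      rw [mem_ball_zero_iff, norm_mul, Complex.norm_real, Real.norm_eq_abs, abs_of_pos hr]
      nlinarith [norm_nonneg z]
    intro a ha b hb hab
    have := hinj (hmem a ha) (hmem b hb) (mul_left_cancel₀ (inv_ne_zero hr') hab)
    exact mul_left_cancel₀ hr' this
  · obtain ⟨s, hs1, hs2⟩ := exists_between hr
    have hr0 : 0 < r := hR0.trans hr
    have hr' : (r : ℂ) ≠ 0 := by exact_mod_cast hr0.ne'
    set g : ℝ → ℝ := fun x => x * (1 + x) ^ 2 / (1 - x) ^ 4 with hg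
    have hgc : ContinuousOn g (Set.Icc (-R) 0) := 
      ContinuousOn.div (by fun_prop) (by fun_prop) fun x hx =>
        pow_ne_zero 4 (by linarith [hx.2] : 0 < 1 - x).ne'
    -- This is the minimum of `f₀` on the negative axis. For `R < s < r` the value at `-s` lies
    -- between it and `0`, so it is taken again on `[-R, 0]`.
    have hgR : g (-R) = -1 / 16 := by
      have : (1 - -R) ^ 4 ≠ 0 := pow_ne_zero 4 (by linarith)
      simp only [hg]
      rw [div_eq_div_iff this (by norm_num)]
      have e1 : (1 + R) ^ 2 = 8 * R := by linarith
      have e2 : (1 - R) ^ 2 = 4 * R := by linarith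
      calc -R * (1 + -R) ^ 2 * 16 = -16 * R * (1 - R) ^ 2 := by ring
        _ = -(8 * R) ^ 2 := by rw [e2]; ring
        _ = -((1 + R) ^ 2) ^ 2 := by rw [e1]
        _ = _ := by ring
    have hgs : g (-s) ∈ Set.Icc (g (-R)) (g 0) := by
      have hpos : 0 < (1 - -s) ^ 4 := by
        have : 0 < 1 - -s := by linarith
        positivity
      constructor
      · rw [hgR]
        simp only [hg]
        rw [div_le_div_iff₀ (by norm_num) hpos]
        -- `(1+s)⁴ - 16 s (1-s)² = ((1+s)² - 8s)²`.
        nlinarith [sq_nonneg ((1 + s) ^ 2 - 8 * s)]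
      · simp only [hg]
        rw [zero_mul, zero_div]
        refine div_nonpos_of_nonpos_of_nonneg ?_ hpos.le
        nlinarith [mul_nonneg (show 0 ≤ s by linarith) (sq_nonneg (1 + -s))]
    obtain ⟨y, hy, hgy⟩ := intermediate_value_Icc (by linarith) hgc hgs
    have hcast : ∀ x : ℝ, dilate r extremalF0 ((x / r : ℝ) : ℂ) = (r : ℂ)⁻¹ * (g x : ℂ) := fun x => by
      rw [dilate, ← Complex.ofReal_mul, mul_div_cancel₀ _ hr0.ne', extremalF0]
      simp [hg]
    have hmem : ∀ x : ℝ, |x| < r → ((x / r : ℝ) : ℂ) ∈ unitDisk := fun x hx => by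
      rwa [unitDisk, mem_ball_zero_iff, Complex.norm_real, Real.norm_eq_abs, abs_div,
        abs_of_pos hr0, div_lt_one hr0]
    have := hS.2 (hmem y (abs_lt.2 ⟨by linarith [hy.1], by linarith [hy.2]⟩))
      (hmem (-s) (abs_lt.2 ⟨by linarith, by linarith⟩)) (by rw [hcast, hcast, hgy])
    rw [Complex.ofReal_inj, div_left_inj' hr0.ne'] at this
    linarith [hy.1]

/-! ### Principal square roots and discs -/

theorem cpow_half_eq_sqrt (z : ℂ) : z ^ (1 / 2 : ℂ) = Complex.sqrt z := by
  rw [one_div, Complex.sqrt]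

theorem csqrt_sq (z : ℂ) : Complex.sqrt z ^ 2 = z := by
  have := Complex.cpow_nat_inv_pow z two_ne_zero
  exact_mod_cast this

theorem csqrt_of_sq {s : ℂ} (hs : 0 < s.re) : Complex.sqrt (s ^ 2) = s :=
  Complex.sq_cpow_two_inv hs

theorem csqrt_re (z : ℂ) : (Complex.sqrt z).re = √((‖z‖ + z.re) / 2) :=
  Complex.cpow_inv_two_re z

theorem csqrt_re_pos {z : ℂ} (hz : 0 < z.re) : 0 < (Complex.sqrt z).re := by
  rw [csqrt_re]
  have := norm_nonneg z
  positivity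

theorem re_le_csqrt_re_sq (z : ℂ) : z.re ≤ (Complex.sqrt z).re ^ 2 := by
  rw [csqrt_re, Real.sq_sqrt (by linarith [(abs_le.1 (Complex.abs_re_le_norm z)).1])]
  linarith [Complex.re_le_norm z]

theorem ne_of_mem_unitDisk_of_norm_eq_one {z w : ℂ} (hz : z ∈ unitDisk) (hw : ‖w‖ = 1) :
    z ≠ w := by
  rintro rfl
  have : ‖z‖ < 1 := by simpa [unitDisk] using hz
  linarith

theorem lt_re_of_norm_sub_lt {F : ℂ} {a c : ℝ} (h : ‖F - a‖ < a - c) : c < F.re := by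
  have := (abs_lt.1 ((Complex.abs_re_le_norm _).trans_lt h)).1
  rw [Complex.sub_re, Complex.ofReal_re] at this
  linarith

/-- The disc has `0` on its boundary, so inversion maps it into the half-plane `Re > 1/(2b)`; this
is that fact cleared of denominators. -/
theorem normSq_lt_of_norm_sub_lt {F : ℂ} {b : ℝ} (h : ‖F - b‖ < b) :
    Complex.normSq F < 2 * b * F.re := by
  have h1 : ‖F - b‖ ^ 2 < b ^ 2 := by nlinarith [norm_nonneg (F - b)]
  rw [Complex.sq_norm, Complex.normSq_apply] at h1
  rw [Complex.normSq_apply]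
  simp at h1
  nlinarith

/-! ### Classes in which `φ` is inverted algebraically -/

theorem isSharpRadius_phiOrder {α : ℝ} (h0 : 0 ≤ α) (h1 : α < 1) :
    IsSharpRadius (starClass (phiOrder α)) classPi1 ((1 - α) / (3 + √(8 + α ^ 2)))
      extremalF0 := by
  set s := √(8 + α ^ 2) with hs
  have hs2 : s ^ 2 = 8 + α ^ 2 := Real.sq_sqrt (by positivity)
  have hs0 : 0 ≤ s := Real.sqrt_nonneg _
  have hα : (α : ℂ) - 1 ≠ 0 := by
    have : α - 1 ≠ 0 := by linarith
    exact_mod_cast this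
  refine isSharpRadius_starClass_left (ω := fun F => (F - 1) / (F + 1 - 2 * α)) (c := α)
    (by have := sub_pos.2 h1; positivity) ?_ h0 h1.le ?_ (by simp) (fun a F _ _ hF => ?_)
    fun w hw h => ?_
  · rw [div_lt_one (by positivity)]
    linarith
  · field_simp
    linear_combination (1 - α) * hs2
  · have hre := lt_re_of_norm_sub_lt hF
    have hne : F + 1 - 2 * (α : ℂ) ≠ 0 := fun h => by
      have := congrArg Complex.re h
      simp at this
      linarith
    have h2 : 1 - (F - 1) / (F + 1 - 2 * (α : ℂ)) = -2 * (α - 1) / (F + 1 - 2 * (α : ℂ)) := by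
      field_simp
      ring
    refine ⟨DifferentiableAt.fun_div (by fun_prop) (by fun_prop) hne, ?_, ?_⟩
    · rw [norm_div, div_lt_one (norm_pos_iff.2 hne)]
      refine lt_of_pow_lt_pow_left₀ 2 (norm_nonneg _) ?_
      rw [Complex.sq_norm, Complex.sq_norm, Complex.normSq_apply, Complex.normSq_apply]
      simp
      nlinarith
    · rw [phiOrder, h2]
      field_simp
      ring
  · have hw1 := one_sub_ne_zero_of_mem_unitDisk hw
    rw [phiOrder, div_eq_iff hw1] at h
    have h3 : (α - 1 : ℂ) * (w - -1) = 0 := by linear_combination -h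
    exact ne_of_mem_unitDisk_of_norm_eq_one hw (by simp)
      (sub_eq_zero.1 ((mul_eq_zero.1 h3).resolve_left hα))

/-- A disc `|F - a| < √2 - a` with `a ≥ 1` lies in `|F - 1| < √2 - 1`, where `|F² - 1| < (√2 - 1)(√2
+ 1) = 1`. -/
theorem isSharpRadius_phiL :
    IsSharpRadius (starClass phiL) classPi1 ((√2 - 1) * (√10 - 3)) extremalF0 := by
  have h2 : √2 ^ 2 = 2 := Real.sq_sqrt (by norm_num)
  have h2l : 1.41 < √2 := Real.lt_sqrt_of_sq_lt (by norm_num)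
  have h2u : √2 < 1.42 := (Real.sqrt_lt' (by norm_num)).2 (by norm_num)
  have h10 : √10 ^ 2 = 10 := Real.sq_sqrt (by norm_num)
  have h10l : 3 < √10 := Real.lt_sqrt_of_sq_lt (by norm_num)
  have h10u : √10 < 3.5 := (Real.sqrt_lt' (by norm_num)).2 (by norm_num)
  refine isSharpRadius_starClass_right (ω := fun F => F ^ 2 - 1) (c := √2)
    (mul_pos (by linarith) (by linarith)) (by nlinarith) (by positivity) ?_ (by simp)
    (fun a F ha hF => ?_) fun w hw h => ?_
  · linear_combination ((√10 - 3) * (√2 + (√2 - 1) * (√10 - 3)) + √2 * (3 - √10)) * h2 + (√2 - 1) * h10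
  · have h3 : ‖F - 1‖ < √2 - 1 := by
      calc ‖F - 1‖ = ‖(F - a) + ((a - 1 : ℝ) : ℂ)‖ := by congr 1; push_cast; ring
        _ ≤ ‖F - a‖ + ‖((a - 1 : ℝ) : ℂ)‖ := norm_add_le _ _
        _ = ‖F - a‖ + (a - 1) := by
          rw [Complex.norm_real, Real.norm_eq_abs, abs_of_nonneg (by linarith)]
        _ < _ := by linarith
    have h4 : ‖F + 1‖ ≤ √2 + 1 := by
      calc ‖F + 1‖ = ‖(F - 1) + 2‖ := by congr 1; ring
        _ ≤ ‖F - 1‖ + ‖(2 : ℂ)‖ := norm_add_le _ _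
        _ ≤ _ := by
          rw [Complex.norm_ofNat]
          linarith
    have hre : 0 < F.re := by
      refine lt_re_of_norm_sub_lt (a := 1) ?_
      rw [Complex.ofReal_one]
      linarith
    refine ⟨by fun_prop, ?_, ?_⟩
    · rw [show F ^ 2 - 1 = (F - 1) * (F + 1) by ring, norm_mul]
      nlinarith [norm_nonneg (F - 1), norm_nonneg (F + 1)]
    · rw [phiL, cpow_half_eq_sqrt, add_sub_cancel, csqrt_of_sq hre]
  · have h3 : ((√2 : ℝ) : ℂ) ^ 2 = 2 := by exact_mod_cast h2
    rw [phiL, cpow_half_eq_sqrt] at h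
    have h4 := csqrt_sq (1 + w)
    rw [h, h3] at h4
    exact ne_of_mem_unitDisk_of_norm_eq_one hw norm_one (by linear_combination -h4)

/-- Completing the square, `φ(w) = 1/3 + (2/3)(1+w)²`, so `w = √ζ - 1` with `ζ = (3F-1)/2`. The
discs become `|ζ - b| < b` with `b ≤ 11/8`; for `s = √ζ` this gives `|s|⁴ < 2b Re ζ ≤ 4 (Re s)²`,
hence `|s - 1| < 1`. -/
theorem isSharpRadius_phiC :
    IsSharpRadius (starClass phiC) classPi1 ((9 - √73) / 4) extremalF0 := by
  have h73 : √73 ^ 2 = 73 := Real.sq_sqrt (by norm_num)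
  have h73l : 8 < √73 := Real.lt_sqrt_of_sq_lt (by norm_num)
  have h73u : √73 < 9 := (Real.sqrt_lt' (by norm_num)).2 (by norm_num)
  refine isSharpRadius_starClass_left (ω := fun F => Complex.sqrt ((3 * F - 1) / 2) - 1)
    (c := 1 / 3) (by linarith) (by linarith) (by norm_num) (by norm_num) ?_ ?_
    (fun a F ha ha' hF => ?_) fun w hw h => ?_
  · linear_combination h73 / 12
  · have := csqrt_of_sq (s := 1) (by simp)
    norm_num at this ⊢
  · have hζ : ‖(3 * F - 1) / 2 - (((3 * a - 1) / 2 : ℝ) : ℂ)‖ < (3 * a - 1) / 2 := by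
      have : (3 * F - 1) / 2 - (((3 * a - 1) / 2 : ℝ) : ℂ) = (3 / 2 : ℝ) * (F - a) := by
        push_cast; ring
      rw [this, norm_mul, Complex.norm_real, Real.norm_eq_abs, abs_of_pos (by norm_num)]
      linarith
    set ζ : ℂ := (3 * F - 1) / 2 with hζdef
    have hre : 0 < ζ.re := lt_re_of_norm_sub_lt (a := (3 * a - 1) / 2) (by simpa using hζ)
    have hn := normSq_lt_of_norm_sub_lt hζ
    have hs := csqrt_re_pos hre
    have hs2 := csqrt_sq ζ
    set s := Complex.sqrt ζ with hsdef
    refine ⟨?_, ?_, ?_⟩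
    · have : DifferentiableAt ℂ Complex.sqrt ((3 * F - 1) / 2) :=
        Complex.differentiableAt_sqrt (Or.inl hre)
      exact (DifferentiableAt.comp (g := Complex.sqrt) F this (by fun_prop)).sub_const 1
    · have e1 : Complex.normSq s ^ 2 = Complex.normSq ζ := by rw [← hs2, map_pow]
      have e2 : ζ.re = s.re ^ 2 - s.im ^ 2 := by
        rw [← hs2, pow_two, Complex.mul_re]; ring
      have e3 : Complex.normSq s < 2 * s.re := by
        refine lt_of_pow_lt_pow_left₀ 2 (by positivity) ?_
        rw [e1]
        nlinarith [sq_nonneg s.im]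
      refine lt_of_pow_lt_pow_left₀ 2 zero_le_one ?_
      rw [Complex.normSq_apply] at e3
      rw [Complex.sq_norm, Complex.normSq_apply]
      simp
      nlinarith
    · rw [phiC]
      linear_combination (2 / 3) * hs2 + (2 / 3) * hζdef
  · rw [phiC] at h
    push_cast at h
    have h3 : (w - -1) ^ 2 = 0 := by linear_combination (3 / 2) * h
    exact ne_of_mem_unitDisk_of_norm_eq_one hw (by simp)
      (sub_eq_zero.1 (pow_eq_zero_iff two_ne_zero |>.1 h3))

/-- Squaring `F - w = √(1+w²)` gives `w = (F²-1)/(2F)`. The lune `|F² - 1| < 2|F|` is bounded by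
arcs of the circles `|F ∓ 1| = √2`, as the factorisation `key` shows; the discs lie inside the first
circle and outside the second. -/
theorem isSharpRadius_phiLune :
    IsSharpRadius (starClass phiLune) classPi1 (3 / √2 - √(1 / 2 * (11 - 2 * √2)))
      extremalF0 := by
  have h2 : √2 ^ 2 = 2 := Real.sq_sqrt (by norm_num)
  have h2l : 1.414 < √2 := Real.lt_sqrt_of_sq_lt (by norm_num)
  have h2u : √2 < 1.415 := (Real.sqrt_lt' (by norm_num)).2 (by norm_num)
  have e : 3 / √2 = 3 * √2 / 2 := by
    field_simp
    linarith
  rw [e]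
  have ht2 : √(1 / 2 * (11 - 2 * √2)) ^ 2 = 1 / 2 * (11 - 2 * √2) := Real.sq_sqrt (by linarith)
  have htl : 2 < √(1 / 2 * (11 - 2 * √2)) := Real.lt_sqrt_of_sq_lt (by linarith)
  have htu : √(1 / 2 * (11 - 2 * √2)) < 2.1 := (Real.sqrt_lt' (by norm_num)).2 (by linarith)
  set t := √(1 / 2 * (11 - 2 * √2)) with ht
  refine isSharpRadius_starClass_left (ω := fun F => (F ^ 2 - 1) / (2 * F))
    (c := √2 - 1) (by linarith) (by linarith) (by linarith) (by linarith) ?_ (by simp)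
    (fun a F ha ha' hF => ?_) fun w hw h => ?_
  · linear_combination √2 * ht2 + (9 / 4 * √2 - 3 * t - 1) * h2
  · have hre : √2 - 1 < F.re := lt_re_of_norm_sub_lt hF
    have hre0 : 0 < F.re := by linarith
    have hF0 : F ≠ 0 := fun h => by simp [h] at hre0
    have h1 : Complex.normSq (F - 1) < 2 := by
      have : ‖F - 1‖ < √2 := by
        calc ‖F - 1‖ = ‖(F - a) + ((a - 1 : ℝ) : ℂ)‖ := by congr 1; push_cast; ring
          _ ≤ ‖F - a‖ + ‖((a - 1 : ℝ) : ℂ)‖ := norm_add_le _ _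
          _ = ‖F - a‖ + (a - 1) := by
            rw [Complex.norm_real, Real.norm_eq_abs, abs_of_nonneg (by linarith)]
          _ < _ := by linarith
      rw [← Complex.sq_norm]
      nlinarith [norm_nonneg (F - 1)]
    have h3 : 2 < Complex.normSq (F + 1) := by
      rw [Complex.normSq_apply, Complex.add_re, Complex.one_re]
      nlinarith [mul_self_nonneg (F + 1).im]
    refine ⟨DifferentiableAt.fun_div (by fun_prop) (by fun_prop) (by simpa using hF0), ?_, ?_⟩
    · rw [norm_div, div_lt_one (by simpa using hF0)]
      refine lt_of_pow_lt_pow_left₀ 2 (norm_nonneg _) ?_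
      have key : Complex.normSq (F ^ 2 - 1) - Complex.normSq (2 * F)
          = (Complex.normSq (F - 1) - 2) * (Complex.normSq (F + 1) - 2) := by
        rw [pow_two]
        simp only [Complex.normSq_apply, Complex.sub_re, Complex.sub_im, Complex.mul_re,
          Complex.mul_im, Complex.add_re, Complex.add_im, Complex.one_re, Complex.one_im,
          Complex.re_ofNat, Complex.im_ofNat]
        ring
      rw [Complex.sq_norm, Complex.sq_norm]
      nlinarith [mul_pos (sub_pos.2 h1) (sub_pos.2 h3)]
    · have e1 : 1 + ((F ^ 2 - 1) / (2 * F)) ^ 2 = ((F + F⁻¹) / 2) ^ 2 := by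
        field_simp
        ring
      have e2 : 0 < ((F + F⁻¹) / 2).re := by
        have : 0 < F⁻¹.re := by
          rw [Complex.inv_re]
          exact div_pos hre0 (Complex.normSq_pos.2 hF0)
        rw [Complex.div_ofNat_re, Complex.add_re]
        linarith
      rw [phiLune, cpow_half_eq_sqrt, e1, csqrt_of_sq e2]
      field_simp
      ring
  · have h3 : ((√2 : ℝ) : ℂ) ^ 2 = 2 := by exact_mod_cast h2
    rw [phiLune, cpow_half_eq_sqrt] at h
    push_cast at h
    set c : ℂ := ((√2 : ℝ) : ℂ) with hc
    have h4 := csqrt_sq (1 + w ^ 2)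
    have h5 : Complex.sqrt (1 + w ^ 2) = c - 1 - w := by linear_combination h
    rw [h5] at h4
    have h6 : (c - 1) * (w - -1) = 0 := by linear_combination (-1 / 2) * h4 + h3 / 2
    have h7 : c - 1 ≠ 0 := by
      have : √2 - 1 ≠ 0 := by linarith
      rw [hc]
      exact_mod_cast this
    exact ne_of_mem_unitDisk_of_norm_eq_one hw (by simp)
      (sub_eq_zero.1 ((mul_eq_zero.1 h6).resolve_left h7))

/-- With `k = √2 + 1` and `g = φ(w) - φ(-1) = (1+w)²/(k(k-w))`, one finds `1 + 4√2/g = q²` for `q =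
(k²-w)/(1+w)`. Solving for `w` gives `ω`, with `k² = 3 + 2√2`, and `|w| < 1` amounts to `Re q > k`.
Inversion of the disc `|g - ρ| < ρ` provides this as soon as `ρ ≤ 2 - √2`. -/
theorem isSharpRadius_phiR :
    IsSharpRadius (starClass phiR) classPi1 ((3 - 2 * √(5 - 2 * √2)) / (2 * √2 - 1))
      extremalF0 := by
  have h2 : √2 ^ 2 = 2 := Real.sq_sqrt (by norm_num)
  have h2l : 1.414 < √2 := Real.lt_sqrt_of_sq_lt (by norm_num)
  have h2u : √2 < 1.415 := (Real.sqrt_lt' (by norm_num)).2 (by norm_num)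
  have ht2 : √(5 - 2 * √2) ^ 2 = 5 - 2 * √2 := Real.sq_sqrt (by linarith)
  have htl : 1.4 < √(5 - 2 * √2) := Real.lt_sqrt_of_sq_lt (by linarith)
  have htu : √(5 - 2 * √2) < 1.49 := (Real.sqrt_lt' (by norm_num)).2 (by linarith)
  set t := √(5 - 2 * √2) with ht
  have hc2 : ((√2 : ℝ) : ℂ) ^ 2 = 2 := by exact_mod_cast h2
  set c : ℂ := ((√2 : ℝ) : ℂ) with hc
  have hk : kR = c + 1 := by rw [kR]; push_cast; rfl
  have hk0 : c + 1 ≠ 0 := by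
    have : √2 + 1 ≠ 0 := by linarith
    rw [hc]
    exact_mod_cast this
  have hkw : ∀ w : ℂ, ‖w‖ < 1 → (c + 1) ^ 2 - (c + 1) * w ≠ 0 := fun w hw h => by
    have h3 : (c + 1) * (c + 1 - w) = 0 := by linear_combination h
    have h4 : w = ((√2 + 1 : ℝ) : ℂ) := by
      push_cast
      linear_combination -((mul_eq_zero.1 h3).resolve_left hk0)
    rw [h4, Complex.norm_real, Real.norm_eq_abs, abs_of_pos (by linarith)] at hw
    linarith
  have hden : 0 < 2 * √2 - 1 := by linarith
  refine isSharpRadius_starClass_left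
    (ω := fun F => (3 + 2 * c - Complex.sqrt (1 + 4 * c / (F - (2 * c - 2)))) /
      (1 + Complex.sqrt (1 + 4 * c / (F - (2 * c - 2)))))
    (c := 2 * √2 - 2) (div_pos (by linarith) hden) ?_ (by linarith) (by linarith) ?_ ?_
    (fun a F ha ha' hF => ?_) fun w hw h => ?_
  · rw [div_lt_one hden]
    linarith
  · field_simp
    linear_combination (8 * √2 - 4) * ht2 + (4 - 8 * √2) * h2
  · have e1 : 1 + 4 * c / (1 - (2 * c - 2)) = (3 + 2 * c) ^ 2 := by
      have : 3 - 2 * c ≠ 0 := by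
        have : 3 - 2 * √2 ≠ 0 := by linarith
        rw [hc]
        exact_mod_cast this
      rw [show 1 - (2 * c - 2) = 3 - 2 * c by ring, eq_comm, ← sub_eq_iff_eq_add', eq_div_iff this]
      linear_combination (-8 * c - 12) * hc2
    have e2 : 0 < (3 + 2 * c).re := by
      rw [hc]
      simp
      positivity
    rw [e1, csqrt_of_sq e2, sub_self, zero_div]
  · set g : ℂ := F - (2 * c - 2) with hg
    set ρ : ℝ := a - (2 * √2 - 2) with hρ
    have hρ0 : 0 < ρ := by linarith
    have hρ1 : ρ ≤ 2 - √2 := by linarith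
    have hgρ : ‖g - ρ‖ < ρ := by
      have : g - ρ = F - a := by rw [hg, hρ, hc]; push_cast; ring
      rwa [this]
    have hgre : 0 < g.re := lt_re_of_norm_sub_lt (a := ρ) (by simpa using hgρ)
    have hg0 : g ≠ 0 := fun h => by simp [h] at hgre
    have hginv : 1 / (2 * ρ) < (g⁻¹).re := by
      have := normSq_lt_of_norm_sub_lt hgρ
      rw [Complex.inv_re, div_lt_div_iff₀ (by positivity) (Complex.normSq_pos.2 hg0)]
      linarith
    have hxre : (1 + √2) ^ 2 < (1 + 4 * c / g).re := by
      have e1 : (1 + 4 * c / g).re = 1 + 4 * √2 * (g⁻¹).re := by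
        rw [show 1 + 4 * c / g = 1 + ((4 * √2 : ℝ) : ℂ) * g⁻¹ by
          rw [hc]; push_cast; rw [div_eq_mul_inv], Complex.add_re, Complex.re_ofReal_mul,
          Complex.one_re]
      rw [e1]
      -- This uses `(1 + √2)(2 - √2) = √2`.
      have e2 : (1 + √2) * ρ ≤ √2 := by nlinarith
      rw [div_lt_iff₀ (by positivity)] at hginv
      have hx0 : 0 < (g⁻¹).re := by
        by_contra! h
        nlinarith
      nlinarith [mul_le_mul_of_nonneg_right e2 hx0.le]
    have hq := re_le_csqrt_re_sq (1 + 4 * c / g)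
    have hq2 := csqrt_sq (1 + 4 * c / g)
    have hqpos := csqrt_re_pos (z := 1 + 4 * c / g) (by nlinarith)
    have hdq : DifferentiableAt ℂ (fun F => Complex.sqrt (1 + 4 * c / (F - (2 * c - 2)))) F := by
      have h1 : DifferentiableAt ℂ Complex.sqrt (1 + 4 * c / (F - (2 * c - 2))) :=
        Complex.differentiableAt_sqrt (Or.inl (by nlinarith))
      refine DifferentiableAt.comp (g := Complex.sqrt) F h1 ?_
      exact ((differentiableAt_const (4 * c)).fun_div
        (differentiableAt_id.sub_const (2 * c - 2)) hg0).const_add 1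
    set q := Complex.sqrt (1 + 4 * c / g) with hqdef
    have hqre : 1 + √2 < q.re := by
      refine lt_of_pow_lt_pow_left₀ 2 hqpos.le (hxre.trans_le hq)
    have hq1 : 1 + q ≠ 0 := fun h => by
      have := congrArg Complex.re h
      simp at this
      linarith
    have hnorm : ‖(3 + 2 * c - q) / (1 + q)‖ < 1 := by
      rw [norm_div, div_lt_one (norm_pos_iff.2 hq1)]
      refine lt_of_pow_lt_pow_left₀ 2 (norm_nonneg _) ?_
      rw [Complex.sq_norm, Complex.sq_norm, Complex.normSq_apply, Complex.normSq_apply, hc]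
      simp
      nlinarith
    refine ⟨((differentiableAt_const _).sub hdq).fun_div (hdq.const_add 1) hq1, hnorm, ?_⟩
    have hd := hkw _ hnorm
    have hF' : F * (q ^ 2 - 1) = (2 * c - 2) * (q ^ 2 - 1) + 4 * c := by
      have : g * (q ^ 2 - 1) = 4 * c := by
        rw [hq2]
        field_simp
        ring
      rw [hg] at this
      linear_combination this
    have hqm : q - 1 ≠ 0 := fun h => by
      have := congrArg Complex.re h
      simp at this
      linarith
    have hw : (3 + 2 * c - q) / (1 + q) * (1 + q) = 3 + 2 * c - q := div_mul_cancel₀ _ hq1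
    rw [phiR, hk]
    generalize (3 + 2 * c - q) / (1 + q) = w at hd hw
    have : (c + 1) * w + w ^ 2 = (F - 1) * ((c + 1) ^ 2 - (c + 1) * w) := by
      clear_value q c
      clear * - hw hc2 hF' hq1 hqm
      grind
    rw [this, mul_div_cancel_right₀ _ hd]
    ring
  · have hd := hkw w (by simpa [unitDisk] using hw)
    rw [phiR, hk] at h
    push_cast at h
    have h3 : (c + 1) * w + w ^ 2 = (2 * c - 3) * ((c + 1) ^ 2 - (c + 1) * w) := by
      rw [← div_eq_iff hd]
      linear_combination h
    have h4 : (w - -1) ^ 2 = 0 := by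
      linear_combination h3 + (2 * c + 1 - 2 * w) * hc2
    exact ne_of_mem_unitDisk_of_norm_eq_one hw (by simp)
      (sub_eq_zero.1 (pow_eq_zero_iff two_ne_zero |>.1 h4))

/-! ### Radial majorants; the exponential and sine classes -/

/-- The mean value inequality along the radius through `v`. It bounds `log` and `arcsin` by their
values on the real axis. -/
theorem norm_le_of_norm_deriv_le_radial {G G' : ℂ → ℂ} {B B' : ℝ → ℝ} {ρ : ℝ}
    (hG : ∀ v : ℂ, ‖v‖ < ρ → HasDerivAt G (G' v) v)
    (hB : ∀ x : ℝ, 0 ≤ x → x < ρ → HasDerivAt B (B' x) x) (hG0 : G 0 = 0) (hB0 : B 0 = 0)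
    (bound : ∀ v : ℂ, ‖v‖ < ρ → ‖G' v‖ ≤ B' ‖v‖) {v : ℂ} (hv : ‖v‖ < ρ) : ‖G v‖ ≤ B ‖v‖ := by
  rcases eq_or_ne v 0 with rfl | hv0
  · simp [hG0, hB0]
  have hn := norm_pos_iff.2 hv0
  have hn' : (‖v‖ : ℂ) ≠ 0 := by exact_mod_cast hn.ne'
  set d : ℂ := v / ‖v‖ with hd
  have hdn : ‖d‖ = 1 := by
    rw [hd, norm_div, Complex.norm_real, norm_norm, div_self hn.ne']
  have hnorm : ∀ x : ℝ, 0 ≤ x → ‖(x : ℂ) * d‖ = x := fun x hx => by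
    rw [norm_mul, hdn, mul_one, Complex.norm_real, Real.norm_eq_abs, abs_of_nonneg hx]
  have hder : ∀ x ∈ Set.Icc 0 ‖v‖, HasDerivAt (fun x : ℝ => G (x * d)) (G' (x * d) * d) x :=
    fun x hx => by
      have h1 : HasDerivAt (fun z : ℂ => z * d) d (x : ℂ) := by
        simpa using (hasDerivAt_id (x : ℂ)).mul_const d
      exact (HasDerivAt.comp (x : ℂ)
        (hG _ ((hnorm x hx.1).trans_lt (hx.2.trans_lt hv))) h1).comp_ofReal
  have := image_norm_le_of_norm_deriv_right_le_deriv_boundary' (f := fun x : ℝ => G (x * d))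
    (B := B) (fun x hx => (hder x hx).continuousAt.continuousWithinAt)
    (fun x hx => (hder x (Set.Ico_subset_Icc_self hx)).hasDerivWithinAt) (by simp [hG0, hB0])
    (fun x hx => (hB x hx.1 (hx.2.trans_lt hv)).continuousAt.continuousWithinAt)
    (fun x hx => (hB x hx.1 (hx.2.trans hv)).hasDerivWithinAt)
    (fun x hx => by
      have := bound (x * d) ((hnorm x hx.1).trans_lt (hx.2.trans hv))
      rwa [hnorm x hx.1, ← mul_one ‖G' _‖, ← hdn, ← norm_mul] at this)
    (Set.right_mem_Icc.2 hn.le)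
  rwa [hd, mul_div_cancel₀ _ hn'] at this

theorem norm_log_cayley_le {v : ℂ} (hv : ‖v‖ < 1) :
    ‖Complex.log (cayley v)‖ ≤ Real.log ((1 + ‖v‖) / (1 - ‖v‖)) := by
  refine norm_le_of_norm_deriv_le_radial (G := fun v => Complex.log (cayley v))
    (B := fun x => Real.log ((1 + x) / (1 - x))) (G' := fun v => 2 / (1 - v ^ 2))
    (B' := fun x => 2 / (1 - x ^ 2)) (ρ := 1) (fun v hv => ?_) (fun x h0 h1 => ?_)
    (by simp [cayley]) (by simp) (fun v hv => ?_) hv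
  · have hD : v ∈ unitDisk := by simpa [unitDisk] using hv
    have hre := cayley_mem_classP.2.2 v hD
    refine ((hasDerivAt_cayley hD).clog (Or.inl hre)).congr_deriv ?_
    have h1 := one_sub_ne_zero_of_mem_unitDisk hD
    have h2 : 1 + v ≠ 0 := fun h => by simp [cayley, h] at hre
    rw [cayley, show 1 - v ^ 2 = (1 - v) * (1 + v) by ring]
    field_simp
  · have h2 : 1 - x ≠ 0 := by linarith
    have h3 : 1 + x ≠ 0 := by linarith
    refine ((((hasDerivAt_id x).const_add 1).fun_div ((hasDerivAt_id x).const_sub 1)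
      h2).log (div_ne_zero h3 h2)).congr_deriv ?_
    rw [show 1 - x ^ 2 = (1 - x) * (1 + x) by ring]
    simp only [id]
    field_simp
    ring
  · have h1 : 0 < 1 - ‖v‖ ^ 2 := by nlinarith [norm_nonneg v]
    have h2 : 1 - ‖v‖ ^ 2 ≤ ‖1 - v ^ 2‖ := by
      have := norm_sub_norm_le (1 : ℂ) (v ^ 2)
      rwa [norm_one, norm_pow] at this
    rw [norm_div, Complex.norm_ofNat]
    gcongr

/-- The disc lies in the one with diameter `[1/e, e]`: the left ends agree and `a ≤ 5/4 < (e +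
1/e)/2`. The larger disc is `|x| < (e-1)/(e+1)` for `x = (F-1)/(F+1)`, and there
`norm_log_cayley_le` gives `|log F| < 1`. -/
theorem isSharpRadius_phiE :
    IsSharpRadius (starClass phiE) classPi1
      ((Real.exp 1 - 1) / (3 * Real.exp 1 + √(8 * Real.exp 1 ^ 2 + 1))) extremalF0 := by
  have he2 : 2.5 < Real.exp 1 := by linarith [Real.exp_one_gt_d9]
  have he0 := Real.exp_pos 1
  have hinv : (Real.exp 1)⁻¹ = Real.exp (-1) := (Real.exp_neg 1).symm
  set e := Real.exp 1 with he
  set s := √(8 * e ^ 2 + 1) with hs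
  have hs2 : s ^ 2 = 8 * e ^ 2 + 1 := Real.sq_sqrt (by positivity)
  have hs0 : 0 ≤ s := Real.sqrt_nonneg _
  have hei : e * e⁻¹ = 1 := mul_inv_cancel₀ he0.ne'
  have hei0 : 0 < e⁻¹ := inv_pos.2 he0
  refine isSharpRadius_starClass_left (ω := Complex.log) (c := e⁻¹)
    (div_pos (by linarith) (by positivity)) ?_ hei0.le (inv_le_one_of_one_le₀ (by linarith)) ?_
    Complex.log_one (fun a F ha ha' hF => ?_) fun w hw h => ?_
  · rw [div_lt_one (by positivity)]
    linarith
  · field_simp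
    linear_combination (e - 1) * hs2
  · have hre : e⁻¹ < F.re := lt_re_of_norm_sub_lt hF
    have hre0 : 0 < F.re := hei0.trans hre
    have hF0 : F ≠ 0 := fun h => by simp [h] at hre0
    have hF1 : F + 1 ≠ 0 := fun h => by
      have := congrArg Complex.re h
      simp at this
      linarith
    have hn : Complex.normSq F < (e + e⁻¹) * F.re - 1 := by
      have h1 : ‖F - a‖ ^ 2 < (a - e⁻¹) ^ 2 := by nlinarith [norm_nonneg (F - a)]
      rw [Complex.sq_norm, Complex.normSq_apply] at h1
      rw [Complex.normSq_apply]
      simp at h1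
      nlinarith [mul_pos (sub_pos.2 hre) (show 0 < e + e⁻¹ - 2 * a by linarith)]
    have hn' : e * (Complex.normSq F + 1) < (e ^ 2 + 1) * F.re := by
      nlinarith [mul_lt_mul_of_pos_left hn he0]
    have hx : ‖(F - 1) / (F + 1)‖ < (e - 1) / (e + 1) := by
      rw [norm_div, div_lt_div_iff₀ (norm_pos_iff.2 hF1) (by linarith)]
      refine lt_of_pow_lt_pow_left₀ 2 (mul_nonneg (by linarith) (norm_nonneg _)) ?_
      rw [mul_pow, mul_pow, Complex.sq_norm, Complex.sq_norm, Complex.normSq_apply,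
        Complex.normSq_apply]
      rw [Complex.normSq_apply] at hn'
      simp
      nlinarith
    have hcay : cayley ((F - 1) / (F + 1)) = F := by
      have h2 : 1 - (F - 1) / (F + 1) = 2 / (F + 1) := by
        field_simp
        ring
      rw [cayley, h2]
      field_simp
      ring
    refine ⟨(Complex.hasDerivAt_log (Or.inl hre0)).differentiableAt, ?_, Complex.exp_log hF0⟩
    have hx1 : ‖(F - 1) / (F + 1)‖ < 1 := hx.trans (by
      rw [div_lt_one (by linarith)]
      linarith)
    have := norm_log_cayley_le hx1
    rw [hcay] at this
    set x := ‖(F - 1) / (F + 1)‖ with hxdef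
    have hx0 : 0 ≤ x := norm_nonneg _
    refine this.trans_lt ?_
    rw [Real.log_lt_iff_lt_exp (div_pos (by linarith) (by linarith)), ← he,
      div_lt_iff₀ (by linarith)]
    rw [lt_div_iff₀ (by linarith)] at hx
    linarith
  · rw [phiE, hinv] at h
    have h1 := congrArg norm h
    rw [Complex.norm_exp, Complex.norm_real, Real.norm_eq_abs, abs_of_pos (Real.exp_pos _),
      Real.exp_eq_exp] at h1
    have h2 := Complex.abs_re_le_norm w
    rw [h1] at h2
    have : ‖w‖ < 1 := by simpa [unitDisk] using hw
    norm_num at h2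
    linarith

/-- The principal branch of the complex arcsine. -/
noncomputable def carcsin (v : ℂ) : ℂ :=
  -Complex.I * Complex.log (Complex.I * v + Complex.sqrt (1 - v ^ 2))

theorem one_sub_sq_re_pos {v : ℂ} (hv : ‖v‖ < 1) : 0 < (1 - v ^ 2).re := by
  have h1 := Complex.re_le_norm (v ^ 2)
  rw [norm_pow] at h1
  rw [Complex.sub_re, Complex.one_re]
  nlinarith [norm_nonneg v]

theorem I_mul_add_csqrt_mul {v : ℂ} :
    (Complex.I * v + Complex.sqrt (1 - v ^ 2)) * (Complex.sqrt (1 - v ^ 2) - Complex.I * v) = 1 := by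
  linear_combination csqrt_sq (1 - v ^ 2) - v ^ 2 * Complex.I_sq

/-- With `s = √(1-v²)`, the number `y = iv + s` satisfies `y(2s - y) = 1`. For real `y ≤ 0` the left
side has real part at most `0`, because `Re s > 0`. -/
theorem I_mul_add_csqrt_mem_slitPlane {v : ℂ} (hv : ‖v‖ < 1) :
    Complex.I * v + Complex.sqrt (1 - v ^ 2) ∈ Complex.slitPlane := by
  have hs := csqrt_re_pos (one_sub_sq_re_pos hv)
  have hmul := I_mul_add_csqrt_mul (v := v)
  set s := Complex.sqrt (1 - v ^ 2)
  by_contra h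
  rw [Complex.mem_slitPlane_iff, not_or, not_lt, not_not] at h
  set y := Complex.I * v + s with hy
  have h2 : s - Complex.I * v = 2 * s - y := by rw [hy]; ring
  rw [h2] at hmul
  have h3 := congrArg Complex.re hmul
  rw [Complex.mul_re, h.2, zero_mul, sub_zero, Complex.one_re, Complex.sub_re,
    show (2 * s).re = 2 * s.re by simp] at h3
  nlinarith [mul_nonneg (neg_nonneg.2 h.1) hs.le, mul_self_nonneg y.re]

theorem sin_carcsin (v : ℂ) : Complex.sin (carcsin v) = v := by
  have hmul := I_mul_add_csqrt_mul (v := v)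
  have hne := left_ne_zero_of_mul_eq_one hmul
  have e1 : carcsin v * Complex.I = Complex.log (Complex.I * v + Complex.sqrt (1 - v ^ 2)) := by
    rw [carcsin]
    linear_combination (-Complex.log (Complex.I * v + Complex.sqrt (1 - v ^ 2))) * Complex.I_sq
  rw [Complex.sin, neg_mul, e1, Complex.exp_neg, Complex.exp_log hne,
    inv_eq_of_mul_eq_one_right hmul]
  linear_combination (-v) * Complex.I_sq

theorem hasDerivAt_csqrt {z : ℂ} (hz : 0 < z.re) :
    HasDerivAt Complex.sqrt (1 / (2 * Complex.sqrt z)) z := by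
  refine (Complex.hasDerivAt_sqrt (Or.inl hz)).congr_deriv ?_
  rw [Complex.sqrt, neg_div, Complex.cpow_neg, one_div (2 : ℂ)]
  field_simp

theorem hasDerivAt_carcsin {v : ℂ} (hv : ‖v‖ < 1) :
    HasDerivAt carcsin (1 / Complex.sqrt (1 - v ^ 2)) v := by
  have hre := one_sub_sq_re_pos hv
  have hs := csqrt_re_pos hre
  have h1 : HasDerivAt (fun v : ℂ => 1 - v ^ 2) (-(2 * v)) v := by
    simpa using ((hasDerivAt_id v).fun_pow 2).const_sub 1
  have h2 : HasDerivAt (fun v : ℂ => Complex.sqrt (1 - v ^ 2)) _ v :=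
    HasDerivAt.comp (h₂ := Complex.sqrt) v (hasDerivAt_csqrt hre) h1
  have h3 : HasDerivAt (fun v : ℂ => Complex.I * v) Complex.I v := by
    simpa using (hasDerivAt_id v).const_mul Complex.I
  have hsl := I_mul_add_csqrt_mem_slitPlane hv
  refine (((h3.fun_add h2).clog hsl).const_mul (-Complex.I)).congr_deriv ?_
  have hs0 : Complex.sqrt (1 - v ^ 2) ≠ 0 := fun h => by simp [h] at hs
  have hsl0 := Complex.slitPlane_ne_zero hsl
  field_simp
  linear_combination (-Complex.sqrt (1 - v ^ 2)) * Complex.I_sq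

theorem norm_carcsin_le {v : ℂ} (hv : ‖v‖ < 1) : ‖carcsin v‖ ≤ Real.arcsin ‖v‖ := by
  refine norm_le_of_norm_deriv_le_radial (fun v hv => hasDerivAt_carcsin hv)
    (fun x h0 h1 => Real.hasDerivAt_arcsin (by linarith) h1.ne) ?_ Real.arcsin_zero
    (fun v hv => ?_) hv
  · have := csqrt_of_sq (s := 1) (by simp)
    rw [one_pow] at this
    simp [carcsin, this]
  · have h1 : 0 < 1 - ‖v‖ ^ 2 := by nlinarith [norm_nonneg v]
    have h2 : 1 - ‖v‖ ^ 2 ≤ ‖1 - v ^ 2‖ := by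
      have := norm_sub_norm_le (1 : ℂ) (v ^ 2)
      rwa [norm_one, norm_pow] at this
    rw [norm_div, norm_one]
    have h3 : √(1 - ‖v‖ ^ 2) ≤ ‖Complex.sqrt (1 - v ^ 2)‖ := by
      refine Real.sqrt_le_iff.2 ⟨norm_nonneg _, ?_⟩
      rwa [← norm_pow (Complex.sqrt _), csqrt_sq]
    have := Real.sqrt_pos.2 h1
    gcongr

theorem isSharpRadius_phiSin :
    IsSharpRadius (starClass phiSin) classPi1
      (Real.sin 1 / (√(9 + Real.sin 1 ^ 2 + 2 * Real.sin 1) + 3)) extremalF0 := by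
  have hπ := Real.pi_gt_three
  have hs0 : 0 < Real.sin 1 := Real.sin_pos_of_pos_of_lt_pi one_pos (by linarith)
  have hs1 : Real.sin 1 ≤ 1 := Real.sin_le_one 1
  have harc : Real.arcsin (Real.sin 1) = 1 := Real.arcsin_sin (by linarith) (by linarith)
  have hsc : ((Real.sin 1 : ℝ) : ℂ) = Complex.sin 1 := by simp
  set s := Real.sin 1 with hs
  have ht2 : √(9 + s ^ 2 + 2 * s) ^ 2 = 9 + s ^ 2 + 2 * s := Real.sq_sqrt (by positivity)
  have ht0 := Real.sqrt_nonneg (9 + s ^ 2 + 2 * s)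
  set t := √(9 + s ^ 2 + 2 * s) with ht
  refine isSharpRadius_starClass_right (ω := fun F => carcsin (F - 1)) (c := 1 + s)
    (by positivity) ?_ (by positivity) ?_ ?_ (fun a F ha hF => ?_) fun w hw h => ?_
  · rw [div_lt_one (by positivity)]
    linarith
  · field_simp
    linear_combination (-s) * ht2
  · simpa using norm_carcsin_le (v := 0) (by simp)
  · have h3 : ‖F - 1‖ < s := by
      calc ‖F - 1‖ = ‖(F - a) + ((a - 1 : ℝ) : ℂ)‖ := by congr 1; push_cast; ring
        _ ≤ ‖F - a‖ + ‖((a - 1 : ℝ) : ℂ)‖ := norm_add_le _ _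
        _ = ‖F - a‖ + (a - 1) := by
          rw [Complex.norm_real, Real.norm_eq_abs, abs_of_nonneg (by linarith)]
        _ < _ := by linarith
    have h4 : ‖F - 1‖ < 1 := h3.trans_le hs1
    refine ⟨(hasDerivAt_carcsin h4).differentiableAt.comp (g := carcsin) F (by fun_prop), ?_, ?_⟩
    · refine (norm_carcsin_le h4).trans_lt ?_
      rw [← harc]
      exact Real.strictMonoOn_arcsin ⟨by linarith [norm_nonneg (F - 1)], h4.le⟩
        ⟨by linarith, hs1⟩ h3
    · rw [phiSin, sin_carcsin]
      ring
  · have hw1 : ‖w‖ < 1 := by simpa [unitDisk] using hw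
    rw [phiSin] at h
    push_cast at h
    rw [hsc] at h
    -- All solutions of `sin w = sin 1` are real, `1 - 2kπ` or `(2k+1)π - 1`, and none has modulus
    -- below `1`.
    obtain ⟨k, hk⟩ := Complex.sin_eq_sin_iff.1 (add_left_cancel h)
    have hbd : ∀ x : ℝ, w = x → |x| < 1 := fun x hx => by
      rwa [hx, Complex.norm_real, Real.norm_eq_abs] at hw1
    rcases hk with hk | hk
    · have := abs_lt.1 (hbd (1 - 2 * k * Real.pi) (by push_cast; linear_combination -hk))
      have h0 : 0 < k := by
        by_contra! h0
        have : (k : ℝ) ≤ 0 := by exact_mod_cast h0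
        nlinarith
      have : (1 : ℝ) ≤ k := by exact_mod_cast h0
      nlinarith
    · have := abs_lt.1 (hbd ((2 * k + 1) * Real.pi - 1) (by push_cast; linear_combination hk))
      rcases le_or_gt 0 k with h0 | h0
      · have : (0 : ℝ) ≤ k := by exact_mod_cast h0
        nlinarith
      · have : (k : ℝ) ≤ -1 := by exact_mod_cast Int.le_sub_one_of_lt h0
        nlinarith

/-! ### The parabolic class -/

/-- The entire function `cosh (κ √u)`. -/
noncomputable def coshSqrt (κ u : ℂ) : ℂ := Complex.cosh (κ * Complex.sqrt u)

theorem coshSqrt_of_sq (κ : ℂ) {s u : ℂ} (h : s ^ 2 = u) :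
    coshSqrt κ u = Complex.cosh (κ * s) := by
  rw [coshSqrt]
  rcases sq_eq_sq_iff_eq_or_eq_neg.1 ((csqrt_sq u).trans h.symm) with h | h
  · rw [h]
  · rw [h, mul_neg, Complex.cosh_neg]

/-- As `cosh` is even, any square root may be used: the principal one off the cut, `i√(-u)` on the
negative axis. The singularity at `0` is removable by continuity. -/
theorem differentiable_coshSqrt (κ : ℂ) : Differentiable ℂ (coshSqrt κ) := by
  have hslit : ∀ u ∈ Complex.slitPlane, DifferentiableAt ℂ (coshSqrt κ) u := fun u hu =>
    ((Complex.differentiableAt_sqrt hu).const_mul κ).ccosh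
  have hne : ∀ u : ℂ, u ≠ 0 → DifferentiableAt ℂ (coshSqrt κ) u := fun u hu => by
    rcases Complex.mem_slitPlane_or_neg_mem_slitPlane hu with h | h
    · exact hslit u h
    · have e : coshSqrt κ = fun u => Complex.cosh (κ * (Complex.I * Complex.sqrt (-u))) := by
        funext u
        refine coshSqrt_of_sq κ ?_
        rw [mul_pow, csqrt_sq, Complex.I_sq]
        ring
      rw [e]
      have h1 : DifferentiableAt ℂ (fun u => Complex.sqrt (-u)) u :=
        DifferentiableAt.comp (g := Complex.sqrt) u (Complex.differentiableAt_sqrt h) (by fun_prop)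
      exact ((h1.const_mul Complex.I).const_mul κ).ccosh
  have hc : ContinuousAt (coshSqrt κ) 0 :=
    Complex.continuous_cosh.continuousAt.comp
      (continuousAt_const.mul (Complex.continuousAt_sqrt (Or.inl le_rfl)))
  have := (Complex.differentiableOn_compl_singleton_and_continuousAt_iff (f := coshSqrt κ)
    (s := Set.univ) (c := 0) Filter.univ_mem).1
    ⟨fun u hu => (hne u (by simpa using hu)).differentiableWithinAt, hc⟩
  exact differentiableOn_univ.1 this

/-- If `F = φ(w)`, the logarithm is `L = ±κ√(F-1)` with `κ = π/√2`, and `w = tanh²(L/2) = (cosh L -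
1)/(cosh L + 1)`. The discs lie in the parabola `|F - 1| < Re F`, which means `|Im L| < π/2`; then
`Re cosh L = cosh(Re L) cos(Im L) > 0`, so `|w| < 1`. -/
theorem isSharpRadius_phiP :
    IsSharpRadius (starClass phiP) classPi1 ((6 - √33) / 3) extremalF0 := by
  have h33 : √33 ^ 2 = 33 := Real.sq_sqrt (by norm_num)
  have h33l : 5 < √33 := Real.lt_sqrt_of_sq_lt (by norm_num)
  have h33u : √33 < 6 := (Real.sqrt_lt' (by norm_num)).2 (by norm_num)
  have h2 : √2 ^ 2 = 2 := Real.sq_sqrt (by norm_num)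
  have h20 : 0 < √2 := by positivity
  have hπ := Real.pi_pos
  set κ : ℝ := Real.pi / √2 with hκ
  have hκ2 : κ ^ 2 = Real.pi ^ 2 / 2 := by rw [hκ, div_pow, h2]
  have hκ0 : 0 < κ := by positivity
  have hπc : (Real.pi : ℂ) ≠ 0 := by exact_mod_cast hπ.ne'
  refine isSharpRadius_starClass_left
    (ω := fun F => (coshSqrt κ (F - 1) - 1) / (coshSqrt κ (F - 1) + 1))
    (c := 1 / 2) (by linarith) (by linarith) (by norm_num) (by norm_num) ?_ ?_
    (fun a F ha ha' hF => ?_) fun w hw h => ?_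
  · linear_combination h33 / 6
  · have : coshSqrt κ 0 = 1 := by
      rw [coshSqrt_of_sq (s := 0) (κ : ℂ) (by simp)]
      simp
    simp [this]
  · have hre : 1 / 2 < F.re := lt_re_of_norm_sub_lt hF
    have hpar : ‖F - 1‖ < F.re := by
      have h1 : ‖F - a‖ ^ 2 < (a - 1 / 2) ^ 2 := by nlinarith [norm_nonneg (F - a)]
      refine lt_of_pow_lt_pow_left₀ 2 (by linarith) ?_
      rw [Complex.sq_norm, Complex.normSq_apply] at *
      simp at h1 ⊢
      nlinarith
    set u := F - 1 with hu
    have hs2 := csqrt_sq u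
    set s := Complex.sqrt u with hs
    have him : s.im ^ 2 < 1 / 2 := by
      have e1 : ‖u‖ = s.re ^ 2 + s.im ^ 2 := by
        rw [← hs2, norm_pow, Complex.sq_norm, Complex.normSq_apply]
        ring
      have e2 : u.re = s.re ^ 2 - s.im ^ 2 := by
        rw [← hs2, pow_two, Complex.mul_re]
        ring
      have e3 : F.re = u.re + 1 := by simp [hu]
      linarith
    have him2 : |κ * s.im| < Real.pi / 2 := by
      refine abs_lt_of_sq_lt_sq ?_ (by positivity)
      rw [mul_pow, hκ2]
      nlinarith [sq_pos_of_pos hπ]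
    have hCre : 0 < (coshSqrt κ u).re := by
      have e1 : (κ : ℂ) * s = ((κ * s.re : ℝ) : ℂ) + ((κ * s.im : ℝ) : ℂ) * Complex.I := by
        push_cast
        linear_combination (-(κ : ℂ)) * Complex.re_add_im s
      rw [coshSqrt, ← hs, e1, Complex.cosh_add, Complex.cosh_mul_I, Complex.sinh_mul_I,
        ← Complex.ofReal_cosh, ← Complex.ofReal_cos, ← Complex.ofReal_sinh, ← Complex.ofReal_sin]
      rw [Complex.add_re, ← Complex.ofReal_mul, ← mul_assoc, ← Complex.ofReal_mul,
        Complex.re_ofReal_mul, Complex.ofReal_re, Complex.I_re, mul_zero, add_zero]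
      exact mul_pos (Real.cosh_pos _) (Real.cos_pos_of_mem_Ioo (abs_lt.1 him2))
    have hC1 : coshSqrt κ u + 1 ≠ 0 := fun h => by
      have := congrArg Complex.re h
      simp at this
      linarith
    have hCd : DifferentiableAt ℂ (fun F => coshSqrt κ (F - 1)) F :=
      (differentiable_coshSqrt κ).differentiableAt.comp F (by fun_prop)
    have hnorm : ‖(coshSqrt κ u - 1) / (coshSqrt κ u + 1)‖ < 1 := by
      simpa using norm_sub_div_add_conj_lt_one (b := 1) hCre (by simp)
    refine ⟨(hCd.sub_const 1).fun_div (hCd.add_const 1) hC1, hnorm, ?_⟩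
    have hw1 : (coshSqrt κ u - 1) / (coshSqrt κ u + 1) ≠ 1 := fun h => by
      rw [h, norm_one] at hnorm
      exact lt_irrefl _ hnorm
    set w := (coshSqrt κ u - 1) / (coshSqrt κ u + 1) with hw
    have hEeq : coshSqrt κ u = (Complex.exp (κ * s) + (Complex.exp (κ * s))⁻¹) / 2 := by
      rw [coshSqrt, Complex.cosh, Complex.exp_neg]
    have hE0 := Complex.exp_ne_zero (κ * s)
    have hlogE : Complex.log (Complex.exp (κ * s)) = κ * s := by
      have : ((κ : ℂ) * s).im = κ * s.im := Complex.im_ofReal_mul _ _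
      refine Complex.log_exp ?_ ?_
      · rw [this]
        linarith [(abs_lt.1 him2).1]
      · rw [this]
        linarith [(abs_lt.1 him2).2]
    have hlogE' : Complex.log (Complex.exp (κ * s))⁻¹ = -(κ * s) := by
      have : (-((κ : ℂ) * s)).im = -(κ * s.im) := by rw [Complex.neg_im, Complex.im_ofReal_mul]
      rw [← Complex.exp_neg]
      refine Complex.log_exp ?_ ?_
      · rw [this]
        linarith [(abs_lt.1 him2).2]
      · rw [this]
        linarith [(abs_lt.1 him2).1]
    set E := Complex.exp (κ * s) with hE
    have hE1 : E + 1 ≠ 0 := fun h => by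
      apply hC1
      rw [hEeq, eq_neg_of_add_eq_zero_left h]
      norm_num
    have hwE : w = ((E - 1) / (E + 1)) ^ 2 := by
      have : (coshSqrt κ u + 1) = (E + 1) ^ 2 / (2 * E) := by
        rw [hEeq]
        field_simp
        ring
      rw [hw, this, hEeq]
      field_simp
      ring
    -- The principal root of `w` may be either of `±(E-1)/(E+1)`. The sign replaces `E` by `E⁻¹`,
    -- and the square of the logarithm is unchanged.
    have hlog2 : Complex.log ((1 + Complex.sqrt w) / (1 - Complex.sqrt w)) ^ 2 = (κ * s) ^ 2 := by
      rcases sq_eq_sq_iff_eq_or_eq_neg.1 ((csqrt_sq w).trans hwE) with h | h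
      · have : (1 + Complex.sqrt w) / (1 - Complex.sqrt w) = E := by
          rw [h, show 1 - (E - 1) / (E + 1) = 2 / (E + 1) by field_simp; ring]
          field_simp
          ring
        rw [this, hlogE]
      · have : (1 + Complex.sqrt w) / (1 - Complex.sqrt w) = E⁻¹ := by
          rw [h, show 1 - -((E - 1) / (E + 1)) = 2 * E / (E + 1) by field_simp; ring]
          field_simp
          ring
        rw [this, hlogE', neg_sq]
    have hκc : (κ : ℂ) ^ 2 = (Real.pi : ℂ) ^ 2 / 2 := by exact_mod_cast hκ2
    rw [phiP, cpow_half_eq_sqrt, hlog2, mul_pow, hs2, hκc, hu]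
    field_simp
    ring
  · rw [phiP, cpow_half_eq_sqrt] at h
    push_cast at h
    have hs2 := csqrt_sq w
    set s := Complex.sqrt w
    have hw1 : w ≠ 1 := ne_of_mem_unitDisk_of_norm_eq_one hw norm_one
    have h1 : 1 - s ≠ 0 := fun h => hw1 (by
      rw [← hs2, ← sub_eq_zero.1 h, one_pow])
    have h3 : 1 + s ≠ 0 := fun h => hw1 (by
      rw [← hs2, eq_neg_of_add_eq_zero_right h]
      norm_num)
    have hx := Complex.exp_log (div_ne_zero h3 h1)
    set L := Complex.log ((1 + s) / (1 - s))
    -- The value `1/2` corresponds to `L = ±iπ/2`, hence to `((1+s)/(1-s))² = -1`, that is `w = s² =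
    -- -1`.
    have hL : L ^ 2 = (Real.pi / 2 * Complex.I) ^ 2 := by
      rw [mul_pow, Complex.I_sq]
      field_simp at h
      linear_combination h / 4
    have hx2 : ((1 + s) / (1 - s)) ^ 2 = -1 := by
      rw [← hx]
      rcases sq_eq_sq_iff_eq_or_eq_neg.1 hL with h | h
      · rw [h, Complex.exp_pi_div_two_mul_I, Complex.I_sq]
      · rw [h, Complex.exp_neg, Complex.exp_pi_div_two_mul_I, inv_pow, Complex.I_sq]
        norm_num
    rw [div_pow, div_eq_iff (pow_ne_zero 2 h1)] at hx2
    refine ne_of_mem_unitDisk_of_norm_eq_one hw (w := -1) (by simp) ?_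
    linear_combination hx2 / 2 - hs2

theorem theorem1 :
    (∀ α : ℝ, 0 ≤ α → α < 1 →
      IsSharpRadius (starClass (phiOrder α)) classPi1
        ((1 - α) / (3 + √(8 + α ^ 2))) extremalF0) ∧
    IsSharpRadius (starClass phiL) classPi1 ((√2 - 1) * (√10 - 3)) extremalF0 ∧
    IsSharpRadius (starClass phiP) classPi1 ((6 - √33) / 3) extremalF0 ∧
    IsSharpRadius (starClass phiE) classPi1
      ((Real.exp 1 - 1) / (3 * Real.exp 1 + √(8 * Real.exp 1 ^ 2 + 1))) extremalF0 ∧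
    IsSharpRadius (starClass phiC) classPi1 ((9 - √73) / 4) extremalF0 ∧
    IsSharpRadius (starClass phiSin) classPi1
      (Real.sin 1 / (√(9 + Real.sin 1 ^ 2 + 2 * Real.sin 1) + 3)) extremalF0 ∧
    IsSharpRadius (starClass phiLune) classPi1
      (3 / √2 - √(1 / 2 * (11 - 2 * √2))) extremalF0 ∧
    IsSharpRadius (starClass phiR) classPi1
      ((3 - 2 * √(5 - 2 * √2)) / (2 * √2 - 1)) extremalF0 ∧
    IsSharpRadius (starClass (phiOrder 0)) classPi1 (3 - 2 * √2) extremalF0 ∧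
    IsSharpRadius classS classPi1 (3 - 2 * √2) extremalF0 := by
  refine ⟨fun α h0 h1 => isSharpRadius_phiOrder h0 h1, isSharpRadius_phiL, isSharpRadius_phiP,
    isSharpRadius_phiE, isSharpRadius_phiC, isSharpRadius_phiSin, isSharpRadius_phiLune,
    isSharpRadius_phiR, ?_, isSharpRadius_classS⟩
  have h2 : √2 ^ 2 = 2 := Real.sq_sqrt (by norm_num)
  have h8 : √(8 + (0 : ℝ) ^ 2) = 2 * √2 := by
    rw [show (8 + (0 : ℝ) ^ 2) = (2 * √2) ^ 2 by rw [mul_pow, h2]; norm_num]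
    exact Real.sqrt_sq (by positivity)
  have e : 3 - 2 * √2 = (1 - 0) / (3 + √(8 + (0 : ℝ) ^ 2)) := by
    rw [h8, eq_div_iff (by positivity)]
    linear_combination (-4) * h2
  rw [e]
  exact isSharpRadius_phiOrder le_rfl one_pos
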